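/- There is an absolute constant $C>0$ such that the following holds. Let $\mathcal X=\mathcal X^{\mathrm{pub}}\times\mathcal X^{\mathrm{priv}}$, where $\mathcal X^{\mathrm{pub}}$ (non-sensitive features) is an arbitrary set and $\mathcal X^{\mathrm{priv}}$ (sensitive features) is finite of size $k\ge 2$. Let $m,n\ge 1$ be integers, $R,G\ge 0$, and for $j=1,\dots,m$ let $\mathcal W_j\subseteq\mathbb R^{d_j}$ be a non-empty convex subset of the closed Euclidean ball of radius $R$ centred at $0$, and $\ell_j:\mathcal W_j\times\mathcal X\to\mathbb R$ a loss such that, for every $x\in\mathcal X$, the function $\ell_j(\cdot\,;x)$ is convex and $G$-Lipschitz with respect to the Euclidean norm. For a dataset $D=(x_1,\dots,x_n)\in\mathcal X^n$ put $\mathcal L_j(w;D)=\frac1n\sum_{i=1}^n\ell_j(w;x_i)$. Two datasets are *neighbors* if they have the same non-sensitive parts and their sensitive parts differ in at most one example; a randomized algorithm $A$ is *$(\varepsilon,\delta)$-semi-sensitive DP* if $\Pr[A(D)\in S]\le e^{\varepsilon}\Pr[A(D')\in S]+\delta$ for all neighboring $D,D'$ and all measurable sets $S$ of outputs. Then for every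 $\delta\in(0,1/2)$ and every $\varepsilon\in(0,\ln(1/\delta))$ there is an $(\varepsilon,\delta)$-semi-sensitive DP algorithm $A$ which, on a dataset $D\in\mathcal X^n$, outputs $(w_1,\dots,w_m)\in\mathcal W_1\times\dots\times\mathcal W_m$ such that, for every dataset $D$ and every $j\in\{1,\dots,m\}$, $$\mathbb E\Big[\mathcal L_j(w_j;D)-\inf_{w'\in\mathcal W_j}\mathcal L_j(w';D)\Big]\;\le\; C\cdot RG\cdot\frac{\big(\ln k\cdot\ln(1/\delta)\big)^{1/4}\cdot\sqrt{\max\Big\{1,\;\ln(mn)+\ln\ln k+\ln\Big(\frac{\sqrt{\ln(1/\delta)}}{\varepsilon}\Big)\Big\}}}{\sqrt{\varepsilon n}} .$$ In particular the bound is polylogarithmic in $k$ and does not depend on the dimensions $d_j$. -/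

import Mathlib

open MeasureTheory

noncomputable section

/-- A dataset of `n` examples, each with a non-sensitive part in `Xpub` and a sensitive part in
`Xpriv`. -/
abbrev Dataset (Xpub Xpriv : Type*) (n : ℕ) : Type _ := Fin n → Xpub × Xpriv

/-- Two datasets are semi-sensitive neighbors if they differ at most in the sensitive part of a
single example. -/
def SemiSensitiveNeighbor {Xpub Xpriv : Type*} {n : ℕ} (D D' : Dataset Xpub Xpriv n) : Prop :=
  (∀ i, (D i).1 = (D' i).1) ∧ ∃ i', ∀ i, i ≠ i' → (D i).2 = (D' i).2

/-- `(ε, δ)`-differential privacy of a randomized mechanism `A` (mapping each dataset to the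
probability distribution of its output) with respect to a neighboring relation. -/
def IsDP {𝒟 Ω : Type*} [MeasurableSpace Ω] (nbr : 𝒟 → 𝒟 → Prop) (ε δ : ℝ)
    (A : 𝒟 → ProbabilityMeasure Ω) : Prop :=
  ∀ D D', nbr D D' → ∀ S : Set Ω, MeasurableSet S →
    (A D : Measure Ω).real S ≤ Real.exp ε * (A D' : Measure Ω).real S + δ

/-- `(ε, δ)`-semi-sensitive differential privacy. -/
def IsSemiSensitiveDP {Xpub Xpriv : Type*} {n : ℕ} {Ω : Type*} [MeasurableSpace Ω] (ε δ : ℝ)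
    (A : Dataset Xpub Xpriv n → ProbabilityMeasure Ω) : Prop :=
  IsDP SemiSensitiveNeighbor ε δ A

/-- The empirical risk `(1/n) ∑ i, ℓ(w; x_i)`. -/
def empiricalRisk {E X : Type*} {n : ℕ} (ℓ : E → X → ℝ) (D : Fin n → X) (w : E) : ℝ :=
  (1 / (n : ℝ)) * ∑ i, ℓ w (D i)

/-- The excess empirical risk of `w` over the domain `W`. -/
def excessRisk {E X : Type*} {n : ℕ} (W : Set E) (ℓ : E → X → ℝ) (D : Fin n → X) (w : E) : ℝ :=
  empiricalRisk ℓ D w - ⨅ w' : W, empiricalRisk ℓ D (w' : E)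

/-- A loss on the domain `W` that is convex and `G`-Lipschitz in its first argument. -/
structure IsConvexLipschitzLoss {E X : Type*} [NormedAddCommGroup E] [NormedSpace ℝ E]
    (W : Set E) (G : ℝ) (ℓ : E → X → ℝ) : Prop where
  convexOn : ∀ x, ConvexOn ℝ W (fun w => ℓ w x)
  lipschitz : ∀ x, ∀ w ∈ W, ∀ w' ∈ W, |ℓ w x - ℓ w' x| ≤ G * ‖w - w'‖

/-- The rate, without the absolute constant. The sum of logarithms under the square root is read
as `max 1 (...)`. -/
def convexRate (R G ε δ : ℝ) (m n k : ℕ) : ℝ :=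
  R * G *
    ((Real.log k * Real.log (1 / δ)) ^ (1 / 4 : ℝ) *
      √(max 1 (Real.log ((m : ℝ) * n) + Real.log (Real.log k)
        + Real.log (√(Real.log (1 / δ)) / ε)))
      / √(ε * n))

end

/-! The public features may be fixed, so only a vector of `n` values in a `k`-element set needs
protection. The mechanism keeps, for each example, a synthetic distribution on these values,
initially uniform, and runs projected subgradient descent for every loss on the synthetic average
gradients. These depend only on earlier outputs, so the descent costs no privacy. Replacing them by
the true gradients changes the linearized regret by at most `2R` times the gradient gap in each
round.

To keep the gaps small, each round selects a loss of nearly maximal gap by the exponential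
mechanism, releases a random sign vector tilted towards that gap, and makes a multiplicative weights
update along it. The average negative log-likelihood of the true values starts at `log k`, stays
nonnegative, and falls in expectation in proportion to the gap, up to small errors
(`step_potential_le`). Hence the gaps cannot be large in many rounds.

No dimension enters because a linear form in tilted signs is sub-Gaussian with variance proxy its
squared Euclidean norm (`sum_softmax_signPairing_mul_exp_le`). The same fact bounds the privacy loss
of the sign vector. Exponential moments of the privacy loss (`renyiMoment_stepProb_le`) multiply
over adaptive rounds, and `sum_le_of_renyiMoment_le` turns them into `(ε, δ)`-privacy.

Balancing the errors fixes the number of rounds (`error_le_of_rounds`). Two regimes are separate: if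
the balanced number is below one, a constant output suffices; if `ε` is so large that the logarithm
in the rate may fail to control `log m`, the whole sensitive vector is released with noise. -/

/-! ### Hoeffding-type and hyperbolic tangent inequalities -/

/-- Hoeffding's lemma for a finitely supported probability distribution. -/
theorem sum_mul_exp_le {ι : Type*} [Fintype ι] {p b : ι → ℝ} {B : ℝ} (hp : ∀ i, 0 ≤ p i)
    (hp1 : ∑ i, p i = 1) (hb : ∀ i, |b i| ≤ B) :
    ∑ i, p i * Real.exp (b i) ≤ Real.exp (∑ i, p i * b i + B ^ 2 / 2) := by
  let _ : MeasurableSpace ι := ⊤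
  set μ : Measure ι := ∑ i, ENNReal.ofReal (p i) • Measure.dirac i with hμ
  have hprob : IsProbabilityMeasure μ := by
    constructor
    rw [hμ, Measure.finsetSum_apply]
    simp only [Measure.smul_apply, measure_univ, smul_eq_mul, mul_one]
    rw [← ENNReal.ofReal_sum_of_nonneg (fun i _ => hp i), hp1, ENNReal.ofReal_one]
  have hint : ∀ f : ι → ℝ, ∫ x, f x ∂μ = ∑ i, p i * f i := by
    intro f
    rw [hμ, integral_finsetSum_measure]
    · refine Finset.sum_congr rfl fun i _ => ?_
      rw [integral_smul_measure, integral_dirac, ENNReal.toReal_ofReal (hp i), smul_eq_mul]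
    · intro i _
      exact (integrable_dirac (by simp)).smul_measure ENNReal.ofReal_ne_top
  have h := (ProbabilityTheory.hasSubgaussianMGF_of_mem_Icc (μ := μ) (X := b) (a := -B) (b := B)
    (measurable_of_finite b).aemeasurable
    (Filter.Eventually.of_forall fun i => abs_le.mp (hb i))).mgf_le 1
  simp only [ProbabilityTheory.mgf, hint, one_mul, Real.exp_sub] at h
  have hB : (((‖B - -B‖₊ / 2) ^ 2 : NNReal) : ℝ) = B ^ 2 := by
    push_cast
    rw [Real.norm_eq_abs, div_pow, sq_abs]
    ring
  rw [hB] at h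
  simp only [mul_div_assoc', ← Finset.sum_div] at h
  rw [div_le_iff₀ (Real.exp_pos _), ← Real.exp_add] at h
  refine h.trans (Real.exp_le_exp.mpr (le_of_eq ?_))
  ring

/-- `cosh` version of Hoeffding's lemma for a two-point distribution. -/
theorem cosh_add_le (θ y : ℝ) :
    Real.cosh (θ + y) ≤ Real.cosh θ * Real.exp (y * Real.tanh θ + y ^ 2 / 2) := by
  have hc := Real.cosh_pos θ
  have h := sum_mul_exp_le (ι := Bool)
    (p := fun b => Real.exp (if b then θ else -θ) / (2 * Real.cosh θ))
    (b := fun b => if b then y else -y) (B := |y|) (fun b => by positivity)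
    (by
      rw [Fintype.sum_bool, ← add_div, Real.cosh_eq]
      simp only [if_true, Bool.false_eq_true, if_false]
      field_simp)
    (fun b => by cases b <;> simp)
  simp only [Fintype.sum_bool, if_true, Bool.false_eq_true, if_false, sq_abs] at h
  have e1 : Real.exp θ / (2 * Real.cosh θ) * Real.exp y
      + Real.exp (-θ) / (2 * Real.cosh θ) * Real.exp (-y)
      = Real.cosh (θ + y) / Real.cosh θ := by
    rw [Real.cosh_eq (θ + y), neg_add, Real.exp_add, Real.exp_add]
    field_simp
  have e2 : Real.exp θ / (2 * Real.cosh θ) * y + Real.exp (-θ) / (2 * Real.cosh θ) * (-y)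
      = y * Real.tanh θ := by
    rw [Real.tanh_eq_sinh_div_cosh, Real.sinh_eq]
    field_simp
    ring
  rw [e1, e2, div_le_iff₀ hc] at h
  linarith

theorem abs_tanh_le {x : ℝ} : |Real.tanh x| ≤ |x| := by
  have key : ∀ y : ℝ, 0 ≤ y → Real.tanh y ≤ y := by
    intro y hy
    have h : MonotoneOn (fun z => z * Real.cosh z - Real.sinh z) (Set.Ici 0) := by
      refine monotoneOn_of_deriv_nonneg (convex_Ici 0) (by fun_prop) (by fun_prop) ?_
      intro z hz
      rw [interior_Ici] at hz
      have : deriv (fun z => z * Real.cosh z - Real.sinh z) z = z * Real.sinh z := by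
        have := ((hasDerivAt_id z).mul (Real.hasDerivAt_cosh z)).sub (Real.hasDerivAt_sinh z)
        change deriv (id * Real.cosh - Real.sinh) z = _
        rw [this.deriv]
        simp
      rw [this]
      exact mul_nonneg (le_of_lt hz) (Real.sinh_nonneg_iff.mpr (le_of_lt hz))
    have := h (Set.mem_Ici.mpr le_rfl) hy hy
    simp only [zero_mul, Real.sinh_zero, sub_zero] at this
    rw [Real.tanh_eq_sinh_div_cosh, div_le_iff₀ (Real.cosh_pos y)]
    linarith
  have hn : ∀ y : ℝ, 0 ≤ y → 0 ≤ Real.tanh y := by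
    intro y hy
    rw [Real.tanh_eq_sinh_div_cosh]
    exact div_nonneg (Real.sinh_nonneg_iff.mpr hy) (Real.cosh_pos y).le
  rcases le_total 0 x with hx | hx
  · rw [abs_of_nonneg (hn x hx), abs_of_nonneg hx]
    exact key x hx
  · have h1 := hn (-x) (by linarith)
    rw [← abs_neg, ← Real.tanh_neg, abs_of_nonneg h1, abs_of_nonpos hx]
    exact key (-x) (by linarith)

/-- On the unit interval `sinh y ≥ y` and `cosh y ≤ 2`. This is why tilts are clipped to the unit
ball: there the mean `tanh` of a tilted sign is comparable to the tilt. -/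
theorem half_sq_le_mul_tanh {x : ℝ} (hx : |x| ≤ 1) : x ^ 2 / 2 ≤ x * Real.tanh x := by
  have key : ∀ y : ℝ, 0 ≤ y → y ≤ 1 → y / 2 ≤ Real.tanh y := by
    intro y hy hy1
    have h1 : y ≤ Real.sinh y := Real.self_le_sinh_iff.mpr hy
    have h2 : Real.cosh y ≤ 2 := by
      refine (Real.cosh_le_exp_half_sq y).trans ?_
      have : Real.exp (y ^ 2 / 2) ≤ Real.exp (1 / 2) := Real.exp_le_exp.mpr (by nlinarith)
      refine this.trans ?_
      have h3 : Real.exp (1 / 2) * Real.exp (1 / 2) = Real.exp 1 := by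
        rw [← Real.exp_add]; norm_num
      nlinarith [Real.exp_one_lt_d9, Real.exp_pos (1 / 2)]
    rw [Real.tanh_eq_sinh_div_cosh, le_div_iff₀ (Real.cosh_pos y)]
    nlinarith
  rcases le_total 0 x with h | h
  · have := key x h (by rwa [abs_of_nonneg h] at hx)
    nlinarith
  · have := key (-x) (by linarith) (by rwa [abs_of_nonpos h] at hx)
    rw [Real.tanh_neg] at this
    nlinarith

/-! ### Gibbs distributions and moments of the privacy loss -/

noncomputable section

/-- The Gibbs distribution with scores `s`. -/
def softmax {ι : Type*} [Fintype ι] (s : ι → ℝ) (i : ι) : ℝ :=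
  Real.exp (s i) / ∑ j, Real.exp (s j)

/-- The exponential moment of order `r` of the privacy loss between two distributions. -/
def renyiMoment {ι : Type*} [Fintype ι] (r : ℝ) (p q : ι → ℝ) : ℝ :=
  ∑ i, p i * (p i / q i) ^ r

section Softmax

variable {ι : Type*} [Fintype ι]

theorem sum_exp_pos [Nonempty ι] (s : ι → ℝ) : 0 < ∑ j, Real.exp (s j) :=
  Finset.sum_pos (fun _ _ => Real.exp_pos _) Finset.univ_nonempty

theorem softmax_pos (s : ι → ℝ) (i : ι) : 0 < softmax s i :=
  haveI : Nonempty ι := ⟨i⟩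
  div_pos (Real.exp_pos _) (sum_exp_pos s)

theorem sum_softmax [Nonempty ι] (s : ι → ℝ) : ∑ i, softmax s i = 1 := by
  simp only [softmax, ← Finset.sum_div]
  exact div_self (sum_exp_pos s).ne'

/-- If the score difference is sub-Gaussian under the first Gibbs distribution, then the privacy
loss between the two Gibbs distributions has small exponential moments. -/
theorem renyiMoment_softmax_le [Nonempty ι] {s s' : ι → ℝ} {μ κ r : ℝ} (hr : 0 ≤ r)
    (h : ∀ x : ℝ, ∑ i, softmax s i * Real.exp (x * (s i - s' i))
      ≤ Real.exp (x * μ + κ * x ^ 2 / 2)) :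
    renyiMoment r (softmax s) (softmax s') ≤ Real.exp (κ * (r * (r + 1)) / 2) := by
  set Z := ∑ j, Real.exp (s j)
  set Z' := ∑ j, Real.exp (s' j)
  have hZ : 0 < Z := sum_exp_pos s
  have hZ' : 0 < Z' := sum_exp_pos s'
  -- The hypothesis at `x = -1` controls the ratio of normalizers, and at `x = r` the remaining
  -- moment; the mean `μ` cancels in the product.
  have hM : Z' / Z ≤ Real.exp (-μ + κ / 2) := by
    have := h (-1)
    calc Z' / Z = ∑ i, softmax s i * Real.exp (-1 * (s i - s' i)) := by
          rw [Finset.sum_div]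
          refine Finset.sum_congr rfl fun i _ => ?_
          rw [softmax, div_mul_eq_mul_div, ← Real.exp_add]
          congr 2
          ring
      _ ≤ _ := this
      _ = _ := by congr 1; ring
  have hratio : ∀ i, softmax s i / softmax s' i = Real.exp (s i - s' i) * (Z' / Z) := by
    intro i
    have := (Real.exp_pos (s' i)).ne'
    simp only [softmax, Real.exp_sub]
    change Real.exp (s i) / Z / (Real.exp (s' i) / Z') = _
    field_simp
  calc renyiMoment r (softmax s) (softmax s')
      = (Z' / Z) ^ r * ∑ i, softmax s i * Real.exp (r * (s i - s' i)) := by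
        rw [renyiMoment, Finset.mul_sum]
        refine Finset.sum_congr rfl fun i _ => ?_
        rw [hratio, Real.mul_rpow (Real.exp_pos _).le (div_pos hZ' hZ).le, ← Real.exp_mul,
          mul_comm (s i - s' i) r]
        ring
    _ ≤ Real.exp (-μ + κ / 2) ^ r * Real.exp (r * μ + κ * r ^ 2 / 2) := by
        refine mul_le_mul (Real.rpow_le_rpow (div_pos hZ' hZ).le hM hr) (h r) ?_ (by positivity)
        exact Finset.sum_nonneg fun i _ => mul_nonneg (softmax_pos s i).le (Real.exp_pos _).le
    _ = _ := by
        rw [← Real.exp_mul, ← Real.exp_add]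
        congr 1
        ring

theorem renyiMoment_softmax_le_of_abs_sub_le [Nonempty ι] {s s' : ι → ℝ} {B r : ℝ} (hr : 0 ≤ r)
    (h : ∀ i, |s i - s' i| ≤ B) :
    renyiMoment r (softmax s) (softmax s') ≤ Real.exp (B ^ 2 * (r * (r + 1)) / 2) := by
  refine renyiMoment_softmax_le (μ := ∑ i, softmax s i * (s i - s' i)) hr fun x => ?_
  refine (sum_mul_exp_le (B := |x| * B) (fun i => (softmax_pos s i).le) (sum_softmax s)
    fun i => ?_).trans (Real.exp_le_exp.mpr (le_of_eq ?_))
  · rw [abs_mul]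
    exact mul_le_mul_of_nonneg_left (h i) (abs_nonneg x)
  · rw [mul_pow, sq_abs, Finset.mul_sum]
    congr 1
    · exact Finset.sum_congr rfl fun i _ => by ring
    · ring

/-- Accuracy of the exponential mechanism. -/
theorem le_sum_softmax_mul_add [Nonempty ι] (a : ι → ℝ) {c : ℝ} (hc : 0 < c) (j : ι) :
    a j ≤ ∑ i, softmax (fun i => c * a i) i * a i + Real.log (Fintype.card ι) / c := by
  set p := softmax fun i => c * a i with hp
  have hppos : ∀ i, 0 < p i := softmax_pos _
  have hp1 : ∑ i, p i = 1 := sum_softmax _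
  set Z := ∑ i, Real.exp (c * a i) with hZdef
  have hZ : 0 < Z := sum_exp_pos _
  set N : ℝ := (Fintype.card ι : ℝ)
  have hN : 0 < N := Nat.cast_pos.mpr Fintype.card_pos
  -- The summand is `-p i * log (p i)`: this is the bound of entropy by `log N`, from `log x ≤ x -
  -- 1`.
  have hent : ∑ i, p i * (Real.log Z - c * a i) ≤ Real.log N := by
    calc ∑ i, p i * (Real.log Z - c * a i)
        ≤ ∑ i, (1 / N + p i * (Real.log N - 1)) := by
          refine Finset.sum_le_sum fun i _ => ?_
          have h1 : Real.log Z - c * a i = Real.log (1 / (p i * N)) + Real.log N := by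
            rw [← Real.log_mul (by have := hppos i; positivity) hN.ne']
            have : 1 / (p i * N) * N = Z / Real.exp (c * a i) := by
              have h2 : p i = Real.exp (c * a i) / Z := rfl
              have h3 := (Real.exp_pos (c * a i)).ne'
              rw [h2]
              field_simp
            rw [this, Real.log_div hZ.ne' (Real.exp_pos _).ne', Real.log_exp]
          have h2 := Real.log_le_sub_one_of_pos
            (show 0 < 1 / (p i * N) by have := hppos i; positivity)
          have h3 : p i * (1 / (p i * N)) = 1 / N := by
            have := (hppos i).ne'
            field_simp
          rw [h1]
          nlinarith [mul_le_mul_of_nonneg_left h2 (hppos i).le]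
      _ = Real.log N := by
          rw [Finset.sum_add_distrib, ← Finset.sum_mul, hp1, Finset.sum_const, Finset.card_univ,
            nsmul_eq_mul]
          change N * (1 / N) + _ = _
          field_simp
          ring
  have hmax : c * a j ≤ Real.log Z := by
    rw [Real.le_log_iff_exp_le hZ]
    exact Finset.single_le_sum (f := fun i => Real.exp (c * a i))
      (fun i _ => (Real.exp_pos _).le) (Finset.mem_univ j)
  have hsum : ∑ i, p i * (Real.log Z - c * a i) = Real.log Z - c * ∑ i, p i * a i := by
    simp only [mul_sub, Finset.sum_sub_distrib, ← Finset.sum_mul, hp1, one_mul, Finset.mul_sum]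
    congr 1
    exact Finset.sum_congr rfl fun i _ => by ring
  rw [← sub_le_iff_le_add', le_div_iff₀ hc]
  nlinarith

end Softmax

/-! ### Exponentially tilted random signs -/

section RandomSigns

variable {κ : Type*} [Fintype κ]

/-- The pairing of a vector with a vector of signs. -/
def signPairing (θ : κ → ℝ) (V : κ → Bool) : ℝ :=
  ∑ r, θ r * (if V r then 1 else -1)

variable [DecidableEq κ]

theorem sum_exp_signPairing (θ : κ → ℝ) :
    ∑ V, Real.exp (signPairing θ V) = ∏ r, (2 * Real.cosh (θ r)) := by
  have h : ∀ r, 2 * Real.cosh (θ r) = ∑ b : Bool, Real.exp (θ r * (if b then 1 else -1)) := by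
    intro r
    rw [Fintype.sum_bool, Real.cosh_eq]
    simp only [if_true, Bool.false_eq_true, if_false, mul_one, mul_neg]
    ring
  simp only [h, Finset.prod_univ_sum, Fintype.piFinset_univ, signPairing, Real.exp_sum]

/-- The signs are independent under the tilt, so the moment generating function is a product of
ratios of `cosh`, each handled by `cosh_add_le`. -/
theorem sum_softmax_signPairing_mul_exp_le (θ c : κ → ℝ) :
    ∑ V, softmax (signPairing θ) V * Real.exp (signPairing c V)
      ≤ Real.exp (∑ r, c r * Real.tanh (θ r) + (∑ r, c r ^ 2) / 2) := by
  have h1 : ∑ V, softmax (signPairing θ) V * Real.exp (signPairing c V)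
      = (∏ r, (2 * Real.cosh (θ r + c r))) / ∏ r, (2 * Real.cosh (θ r)) := by
    rw [← sum_exp_signPairing θ, ← sum_exp_signPairing fun r => θ r + c r, Finset.sum_div]
    refine Finset.sum_congr rfl fun V _ => ?_
    rw [softmax, div_mul_eq_mul_div, ← Real.exp_add]
    simp only [signPairing, ← Finset.sum_add_distrib, add_mul]
  have hpos : ∀ r, 0 < 2 * Real.cosh (θ r) := fun r => by have := Real.cosh_pos (θ r); positivity
  rw [h1, div_le_iff₀ (Finset.prod_pos fun r _ => hpos r), Finset.sum_div,
    ← Finset.sum_add_distrib, Real.exp_sum, ← Finset.prod_mul_distrib]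
  refine Finset.prod_le_prod (fun r _ => ?_) fun r _ => ?_
  · have := Real.cosh_pos (θ r + c r)
    positivity
  · have := cosh_add_le (θ r) (c r)
    linarith

theorem renyiMoment_signPairing_le (θ θ' : κ → ℝ) {B r : ℝ} (hr : 0 ≤ r)
    (h : ∑ i, (θ i - θ' i) ^ 2 ≤ B) :
    renyiMoment r (softmax (signPairing θ)) (softmax (signPairing θ'))
      ≤ Real.exp (B * (r * (r + 1)) / 2) := by
  refine renyiMoment_softmax_le (μ := ∑ i, (θ i - θ' i) * Real.tanh (θ i)) hr fun x => ?_
  have e : ∀ V, x * (signPairing θ V - signPairing θ' V)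
      = signPairing (fun i => x * (θ i - θ' i)) V := by
    intro V
    simp only [signPairing, ← Finset.sum_sub_distrib, Finset.mul_sum]
    exact Finset.sum_congr rfl fun i _ => by ring
  simp only [e]
  refine (sum_softmax_signPairing_mul_exp_le θ _).trans (Real.exp_le_exp.mpr ?_)
  have e1 : ∑ i, x * (θ i - θ' i) * Real.tanh (θ i)
      = x * ∑ i, (θ i - θ' i) * Real.tanh (θ i) := by
    rw [Finset.mul_sum]
    exact Finset.sum_congr rfl fun i _ => by ring
  have e2 : ∑ i, (x * (θ i - θ' i)) ^ 2 = x ^ 2 * ∑ i, (θ i - θ' i) ^ 2 := by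
    rw [Finset.mul_sum]
    exact Finset.sum_congr rfl fun i _ => by ring
  rw [e1, e2]
  nlinarith [mul_le_mul_of_nonneg_left h (sq_nonneg x)]

end RandomSigns

/-! ### From moments to approximate privacy, and composition -/

section Renyi

/-- Exponential moments of the privacy loss give approximate differential privacy. -/
theorem sum_le_of_renyiMoment_le {ι : Type*} [Fintype ι] {p q : ι → ℝ} {r ε δ : ℝ} (hr : 0 ≤ r)
    (hp : ∀ i, 0 < p i) (hq : ∀ i, 0 < q i)
    (h : renyiMoment r p q ≤ δ * Real.exp (r * ε)) (S : Finset ι) :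
    ∑ i ∈ S, p i ≤ Real.exp ε * ∑ i ∈ S, q i + δ := by
  -- A Markov argument: where the likelihood ratio exceeds `e^ε`, its `r`-th power times `e^(-rε)`
  -- is at least one.
  have key : ∀ i, p i ≤ Real.exp ε * q i + p i * (p i / q i) ^ r * Real.exp (-(r * ε)) := by
    intro i
    have h0 : 0 ≤ p i * (p i / q i) ^ r * Real.exp (-(r * ε)) :=
      mul_nonneg (mul_nonneg (hp i).le (Real.rpow_nonneg (div_pos (hp i) (hq i)).le r))
        (Real.exp_pos _).le
    rcases le_total (p i) (Real.exp ε * q i) with hle | hle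
    · linarith
    · have h1 : Real.exp ε ≤ p i / q i := by rwa [le_div_iff₀ (hq i)]
      have h2 : Real.exp (r * ε) ≤ (p i / q i) ^ r := by
        rw [mul_comm, Real.exp_mul]
        exact Real.rpow_le_rpow (Real.exp_pos _).le h1 hr
      have h3 : 1 ≤ (p i / q i) ^ r * Real.exp (-(r * ε)) := by
        rw [Real.exp_neg, ← div_eq_mul_inv, le_div_iff₀ (Real.exp_pos _)]
        linarith
      have h4 : 0 ≤ Real.exp ε * q i := mul_nonneg (Real.exp_pos _).le (hq i).le
      have := mul_le_mul_of_nonneg_left h3 (hp i).le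
      linarith
  have hterm : ∀ i, 0 ≤ p i * (p i / q i) ^ r := fun i =>
    mul_nonneg (hp i).le (Real.rpow_nonneg (div_pos (hp i) (hq i)).le r)
  calc ∑ i ∈ S, p i
      ≤ ∑ i ∈ S, (Real.exp ε * q i + p i * (p i / q i) ^ r * Real.exp (-(r * ε))) :=
        Finset.sum_le_sum fun i _ => key i
    _ = Real.exp ε * ∑ i ∈ S, q i + (∑ i ∈ S, p i * (p i / q i) ^ r) * Real.exp (-(r * ε)) := by
        rw [Finset.sum_add_distrib, Finset.mul_sum, Finset.sum_mul]
    _ ≤ Real.exp ε * ∑ i ∈ S, q i + renyiMoment r p q * Real.exp (-(r * ε)) := by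
        gcongr
        exact Finset.sum_le_sum_of_subset_of_nonneg (Finset.subset_univ S) fun i _ _ => hterm i
    _ ≤ Real.exp ε * ∑ i ∈ S, q i + δ := by
        gcongr
        rw [Real.exp_neg, ← div_eq_mul_inv, div_le_iff₀ (Real.exp_pos _)]
        exact h

/-- The exponential moments multiply under dependent composition. -/
theorem renyiMoment_sigma_le {ι : Type*} [Fintype ι] {β : ι → Type*} [∀ i, Fintype (β i)]
    {p q : ι → ℝ} {p' q' : ∀ i, β i → ℝ} {r A B : ℝ} (hp : ∀ i, 0 ≤ p i) (hq : ∀ i, 0 ≤ q i)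
    (hp' : ∀ i b, 0 ≤ p' i b) (hq' : ∀ i b, 0 ≤ q' i b) (hA : renyiMoment r p q ≤ A)
    (hB : ∀ i, renyiMoment r (p' i) (q' i) ≤ B) (hB0 : 0 ≤ B) :
    renyiMoment r (fun x : Σ i, β i => p x.1 * p' x.1 x.2)
      (fun x : Σ i, β i => q x.1 * q' x.1 x.2) ≤ A * B := by
  calc renyiMoment r (fun x : Σ i, β i => p x.1 * p' x.1 x.2)
        (fun x : Σ i, β i => q x.1 * q' x.1 x.2)
      = ∑ i, p i * (p i / q i) ^ r * renyiMoment r (p' i) (q' i) := by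
        simp only [renyiMoment, Finset.mul_sum]
        rw [Fintype.sum_sigma]
        refine Finset.sum_congr rfl fun i _ => Finset.sum_congr rfl fun b _ => ?_
        rw [mul_div_mul_comm, Real.mul_rpow (div_nonneg (hp i) (hq i))
          (div_nonneg (hp' i b) (hq' i b))]
        ring
    _ ≤ ∑ i, p i * (p i / q i) ^ r * B := by
        refine Finset.sum_le_sum fun i _ => mul_le_mul_of_nonneg_left (hB i) ?_
        exact mul_nonneg (hp i) (Real.rpow_nonneg (div_nonneg (hp i) (hq i)) r)
    _ = renyiMoment r p q * B := by rw [renyiMoment, Finset.sum_mul]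
    _ ≤ A * B := mul_le_mul_of_nonneg_right hA hB0

end Renyi

/-! ### Adaptive processes -/

section Adaptive

variable {S Ω : Type*}

/-- The probability of a sequence of `T` outcomes of an adaptive process with transition
probabilities `p` and state update `u`, started in a given state. -/
def pathProb (p : S → Ω → ℝ) (u : S → Ω → S) : (T : ℕ) → S → (Fin T → Ω) → ℝ
  | 0, _, _ => 1
  | T + 1, s, ω => p s (ω 0) * pathProb p u T (u s (ω 0)) (Fin.tail ω)

/-- The states visited before each of `T` outcomes. -/
def pathState (u : S → Ω → S) : (T : ℕ) → S → (Fin T → Ω) → Fin T → S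
  | 0, _, _ => Fin.elim0
  | T + 1, s, ω => Fin.cons s (pathState u T (u s (ω 0)) (Fin.tail ω))

theorem pathState_mem {u : S → Ω → S} {I : Set S} (hI : ∀ s ∈ I, ∀ a, u s a ∈ I) :
    ∀ (T : ℕ) (s : S), s ∈ I → ∀ (ω : Fin T → Ω) (t : Fin T), pathState u T s ω t ∈ I
  | 0, _, _, _, t => t.elim0
  | T + 1, s, hs, ω, t => by
    refine Fin.cases ?_ (fun t' => ?_) t
    · simpa [pathState] using hs
    · simpa [pathState] using pathState_mem hI T _ (hI s hs _) _ t'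

theorem pathProb_pos {p : S → Ω → ℝ} (hp : ∀ s a, 0 < p s a) (u : S → Ω → S) :
    ∀ (T : ℕ) (s : S) (ω : Fin T → Ω), 0 < pathProb p u T s ω
  | 0, _, _ => one_pos
  | T + 1, _, _ => mul_pos (hp _ _) (pathProb_pos hp u T _ _)

variable [Fintype Ω]

theorem sum_fin_succ_arrow {T : ℕ} (f : (Fin (T + 1) → Ω) → ℝ) :
    ∑ ω, f ω = ∑ a, ∑ ω' : Fin T → Ω, f (Fin.cons a ω') := by
  rw [← (Fin.consEquiv fun _ : Fin (T + 1) => Ω).sum_comp, Fintype.sum_prod_type]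
  rfl

theorem sum_pathProb {p : S → Ω → ℝ} (hp : ∀ s, ∑ a, p s a = 1) (u : S → Ω → S) :
    ∀ (T : ℕ) (s : S), ∑ ω, pathProb p u T s ω = 1
  | 0, _ => by simp [pathProb]
  | T + 1, s => by
    rw [sum_fin_succ_arrow]
    simp only [pathProb, Fin.cons_zero, Fin.tail_cons, ← Finset.mul_sum, sum_pathProb hp u T,
      mul_one, hp]

/-- The update `u` is common to both processes, so given the outcomes the states agree, and the
uniform one-round bound composes by `renyiMoment_sigma_le`. -/
theorem renyiMoment_pathProb_le {p q : S → Ω → ℝ} (hp : ∀ s a, 0 < p s a)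
    (hq : ∀ s a, 0 < q s a) (u : S → Ω → S) {r A : ℝ} (hA : 0 ≤ A)
    (h : ∀ s, renyiMoment r (p s) (q s) ≤ A) :
    ∀ (T : ℕ) (s : S), renyiMoment r (pathProb p u T s) (pathProb q u T s) ≤ A ^ T
  | 0, _ => by simp [renyiMoment, pathProb]
  | T + 1, s => by
    have := renyiMoment_sigma_le (β := fun _ : Ω => Fin T → Ω) (r := r)
      (p' := fun a => pathProb p u T (u s a)) (q' := fun a => pathProb q u T (u s a))
      (fun a => (hp s a).le) (fun a => (hq s a).le)
      (fun a ω => (pathProb_pos hp u T _ ω).le) (fun a ω => (pathProb_pos hq u T _ ω).le) (h s)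
      (fun a => renyiMoment_pathProb_le hp hq u hA h T (u s a)) (pow_nonneg hA T)
    rw [pow_succ']
    refine le_trans (le_of_eq ?_) this
    simp only [renyiMoment]
    rw [sum_fin_succ_arrow, Fintype.sum_sigma]
    simp only [pathProb, Fin.cons_zero, Fin.tail_cons]

/-- A potential argument along an adaptive process. -/
theorem sum_pathProb_mul_sum_le {p : S → Ω → ℝ} (hp : ∀ s a, 0 < p s a)
    (hp1 : ∀ s, ∑ a, p s a = 1) {u : S → Ω → S} {I : Set S} (hI : ∀ s ∈ I, ∀ a, u s a ∈ I)
    {c Ψ : S → ℝ} {b : ℝ} (hΨ : ∀ s, 0 ≤ Ψ s)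
    (h : ∀ s ∈ I, c s + ∑ a, p s a * Ψ (u s a) ≤ Ψ s + b) :
    ∀ (T : ℕ) (s : S), s ∈ I →
      ∑ ω, pathProb p u T s ω * ∑ t, c (pathState u T s ω t) ≤ Ψ s + T * b
  | 0, s, _ => by simpa [pathProb] using hΨ s
  | T + 1, s, hs => by
    rw [sum_fin_succ_arrow]
    simp only [pathProb, pathState, Fin.cons_zero, Fin.tail_cons, Fin.sum_univ_succ, Fin.cons_succ]
    calc ∑ a, ∑ ω' : Fin T → Ω, p s a * pathProb p u T (u s a) ω' *
            (c s + ∑ t, c (pathState u T (u s a) ω' t))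
        = ∑ a, p s a * (c s + ∑ ω', pathProb p u T (u s a) ω' *
            ∑ t, c (pathState u T (u s a) ω' t)) := by
          refine Finset.sum_congr rfl fun a _ => ?_
          have : c s = ∑ ω', pathProb p u T (u s a) ω' * c s := by
            rw [← Finset.sum_mul, sum_pathProb hp1, one_mul]
          conv_rhs => rw [this]
          rw [← Finset.sum_add_distrib, Finset.mul_sum]
          exact Finset.sum_congr rfl fun ω' _ => by ring
      _ ≤ ∑ a, p s a * (c s + (Ψ (u s a) + T * b)) := by
          refine Finset.sum_le_sum fun a _ => mul_le_mul_of_nonneg_left ?_ (hp s a).le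
          have := sum_pathProb_mul_sum_le hp hp1 hI hΨ h T (u s a) (hI s hs a)
          linarith
      _ = c s + ∑ a, p s a * Ψ (u s a) + T * b := by
          simp only [mul_add, Finset.sum_add_distrib, ← Finset.sum_mul, hp1]
          ring
      _ ≤ Ψ s + (T + 1 : ℕ) * b := by
          have := h s hs
          push_cast
          linarith

end Adaptive

end

/-! ### Projections, subgradients and extensions -/

section Convex

open scoped InnerProductSpace

variable {E : Type*} [NormedAddCommGroup E] [InnerProductSpace ℝ E]

/-- The metric projection onto a complete convex set decreases the distance to its points. -/
theorem exists_projection {K : Set E} (hne : K.Nonempty) (hK : IsComplete K)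
    (hconv : Convex ℝ K) (x : E) : ∃ y ∈ K, ∀ z ∈ K, ‖y - z‖ ≤ ‖x - z‖ := by
  obtain ⟨y, hy, hmin⟩ := exists_norm_eq_iInf_of_complete_convex hne hK hconv x
  rw [norm_eq_iInf_iff_real_inner_le_zero hconv hy] at hmin
  refine ⟨y, hy, fun z hz => ?_⟩
  have h := hmin z hz
  have e : ‖x - z‖ ^ 2 = ‖x - y‖ ^ 2 - 2 * ⟪x - y, z - y⟫_ℝ + ‖y - z‖ ^ 2 := by
    rw [show x - z = (x - y) - (z - y) by abel, norm_sub_sq_real, norm_sub_rev z y]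
  refine le_of_sq_le_sq ?_ (norm_nonneg _)
  nlinarith [sq_nonneg ‖x - y‖]

/-- This controls the sensitivity of the clipped tilt. The difference splits into a rescaled `x - y`
and a change of the factor, each of norm at most `‖x - y‖`; the crude constant `2` suffices. -/
theorem norm_smul_sub_smul_le (x y : E) :
    ‖(max 1 ‖x‖)⁻¹ • x - (max 1 ‖y‖)⁻¹ • y‖ ≤ 2 * ‖x - y‖ := by
  set a := max 1 ‖x‖ with ha
  set b := max 1 ‖y‖ with hb
  have ha1 : 1 ≤ a := le_max_left _ _
  have hb1 : 1 ≤ b := le_max_left _ _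
  have hyb : ‖y‖ ≤ b := le_max_right _ _
  have hab : |b - a| ≤ ‖x - y‖ := by
    rw [hb, ha, norm_sub_rev]
    refine (abs_max_sub_max_le_max _ _ _ _).trans ?_
    simpa using abs_norm_sub_norm_le y x
  have e : a⁻¹ • x - b⁻¹ • y = a⁻¹ • (x - y) + ((b - a) / (a * b)) • y := by
    have : a⁻¹ - b⁻¹ = (b - a) / (a * b) := by field_simp
    rw [← this, smul_sub, sub_smul]
    abel
  have h1 : ‖a⁻¹ • (x - y)‖ ≤ ‖x - y‖ := by
    rw [norm_smul, Real.norm_of_nonneg (by positivity)]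
    exact mul_le_of_le_one_left (norm_nonneg _) (inv_le_one_of_one_le₀ ha1)
  have h2 : ‖((b - a) / (a * b)) • y‖ ≤ ‖x - y‖ := by
    rw [norm_smul, Real.norm_eq_abs, abs_div, abs_of_pos (show 0 < a * b by positivity),
      div_mul_eq_mul_div, div_le_iff₀ (by positivity)]
    exact mul_le_mul hab (hyb.trans (le_mul_of_one_le_left (by positivity) ha1)) (norm_nonneg _)
      (norm_nonneg _)
  rw [e]
  exact (norm_add_le _ _).trans (by linarith)

/-- A convex continuous function has a subgradient at every point. -/
theorem ConvexOn.exists_subgradient [CompleteSpace E] {f : E → ℝ} (hf : ConvexOn ℝ Set.univ f)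
    (hc : Continuous f) (x : E) : ∃ g : E, ∀ z, f x + ⟪g, z - x⟫_ℝ ≤ f z := by
  have hopen : IsOpen {p : E × ℝ | p.1 ∈ Set.univ ∧ f p.1 < p.2} := by
    simp only [Set.mem_univ, true_and]
    exact isOpen_lt (hc.comp continuous_fst) continuous_snd
  obtain ⟨φ, hφ⟩ := geometric_hahn_banach_open_point hf.convex_strict_epigraph hopen
    (show (x, f x) ∉ {p : E × ℝ | p.1 ∈ Set.univ ∧ f p.1 < p.2} by simp)
  have hφ' : ∀ z t, f z < t → φ (z, t) < φ (x, f x) := fun z t h => hφ (z, t) ⟨trivial, h⟩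
  set c := φ (0, 1) with hcdef
  have hsplit : ∀ z t, φ (z, t) = φ (z, 0) + t * c := by
    intro z t
    have : ((z, t) : E × ℝ) = (z, 0) + t • (0, 1) := by simp
    rw [this, map_add, map_smul, smul_eq_mul]
  -- The separating functional is not vertical, since it strictly decreases when moving up from the
  -- graph; dividing by `-c` gives the subgradient.
  have hcneg : c < 0 := by
    have := hφ' x (f x + 1) (by linarith)
    rw [hsplit, hsplit x (f x)] at this
    linarith
  set ψ : E →L[ℝ] ℝ := φ.comp (ContinuousLinearMap.inl ℝ E ℝ) with hψ
  have hψa : ∀ z, φ (z, 0) = ψ z := fun z => rfl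
  refine ⟨(-c)⁻¹ • (InnerProductSpace.toDual ℝ E).symm ψ, fun z => ?_⟩
  rw [real_inner_smul_left, InnerProductSpace.toDual_symm_apply, map_sub]
  have hle : φ (z, f z) ≤ φ (x, f x) := by
    refine le_of_forall_pos_lt_add fun e he => ?_
    have h1 := hφ' z (f z + e / (-c)) (by
      have : 0 < e / (-c) := div_pos he (by linarith)
      linarith)
    rw [hsplit, add_mul] at h1
    rw [hsplit]
    have h2 : e / (-c) * c = -e := by
      have := hcneg.ne
      field_simp
    linarith
  rw [hsplit, hsplit x (f x), hψa, hψa] at hle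
  rw [← le_sub_iff_add_le', inv_mul_le_iff₀ (by linarith)]
  linarith

theorem norm_subgradient_le {f : E → ℝ} {G : ℝ} {x g : E} (hG : 0 ≤ G)
    (hL : ∀ z, f z - f x ≤ G * ‖z - x‖) (hg : ∀ z, f x + ⟪g, z - x⟫_ℝ ≤ f z) : ‖g‖ ≤ G := by
  by_contra! h
  have h1 := hL (x + g)
  have h2 := hg (x + g)
  rw [add_sub_cancel_left] at h1 h2
  rw [real_inner_self_eq_norm_sq] at h2
  nlinarith

/-- The infimal convolution of `f` with `G * ‖·‖` works, because `f w + G * ‖z - w‖` is jointly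
convex in `(z, w)`. It makes subgradients bounded by `G` available everywhere, although `W` may lack
interior and need not be closed. -/
theorem exists_convex_lipschitz_extension {W : Set E} (hne : W.Nonempty) {f : E → ℝ} {G : ℝ}
    (hG : 0 ≤ G) (hf : ConvexOn ℝ W f) (hL : ∀ w ∈ W, ∀ w' ∈ W, |f w - f w'| ≤ G * ‖w - w'‖) :
    ∃ F : E → ℝ, ConvexOn ℝ Set.univ F ∧ (∀ x y, F x - F y ≤ G * ‖x - y‖) ∧
      ∀ w ∈ W, F w = f w := by
  obtain ⟨w₀, hw₀⟩ := hne
  have : Nonempty W := ⟨⟨w₀, hw₀⟩⟩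
  set F : E → ℝ := fun z => ⨅ w : W, (f w + G * ‖z - w‖) with hF
  have hbdd : ∀ z : E, BddBelow (Set.range fun w : W => f w + G * ‖z - (w : E)‖) := by
    intro z
    refine ⟨f w₀ - G * ‖z - w₀‖, ?_⟩
    rintro _ ⟨w, rfl⟩
    have h1 := (abs_le.mp (hL w w.2 w₀ hw₀)).1
    have h2 : ‖(w : E) - w₀‖ ≤ ‖z - w₀‖ + ‖z - w‖ := by
      rw [show (w : E) - w₀ = (z - w₀) - (z - w) by abel]
      exact norm_sub_le _ _
    have := mul_le_mul_of_nonneg_left h2 hG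
    simp only
    linarith
  have hle : ∀ z : E, ∀ w ∈ W, F z ≤ f w + G * ‖z - w‖ := fun z w hw => ciInf_le (hbdd z) ⟨w, hw⟩
  have happrox : ∀ z : E, ∀ e > 0, ∃ w ∈ W, f w + G * ‖z - w‖ < F z + e := by
    intro z e he
    obtain ⟨w, hw⟩ := exists_lt_of_ciInf_lt (show ⨅ w : W, (f w + G * ‖z - w‖) < F z + e by
      change F z < F z + e
      linarith)
    exact ⟨w, w.2, hw⟩
  refine ⟨F, ⟨convex_univ, ?_⟩, ?_, ?_⟩
  · intro x _ y _ a b ha hb hab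
    refine le_of_forall_pos_lt_add fun e he => ?_
    obtain ⟨u, hu, hu'⟩ := happrox x e he
    obtain ⟨v, hv, hv'⟩ := happrox y e he
    have h1 := hle (a • x + b • y) _ (hf.1 hu hv ha hb hab)
    have h2 := hf.2 hu hv ha hb hab
    have h3 : ‖a • x + b • y - (a • u + b • v)‖ ≤ a * ‖x - u‖ + b * ‖y - v‖ := by
      rw [show a • x + b • y - (a • u + b • v) = a • (x - u) + b • (y - v) by
        rw [smul_sub, smul_sub]; abel]
      refine (norm_add_le _ _).trans (le_of_eq ?_)
      rw [norm_smul, norm_smul, Real.norm_of_nonneg ha, Real.norm_of_nonneg hb]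
    have h4 := mul_le_mul_of_nonneg_left h3 hG
    simp only [smul_eq_mul] at h2 ⊢
    have h5 : a * (f u + G * ‖x - u‖) + b * (f v + G * ‖y - v‖) < a * F x + b * F y + e := by
      rcases ha.eq_or_lt with rfl | ha'
      · have : b = 1 := by linarith
        subst this
        linarith
      · nlinarith [mul_lt_mul_of_pos_left hu' ha', mul_le_mul_of_nonneg_left hv'.le hb]
    linarith
  · intro x y
    rw [sub_le_iff_le_add']
    refine le_of_forall_pos_lt_add fun e he => ?_
    obtain ⟨v, hv, hv'⟩ := happrox y e he
    have h1 := hle x v hv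
    have h2 : ‖x - v‖ ≤ ‖x - y‖ + ‖y - v‖ := norm_sub_le_norm_sub_add_norm_sub x y v
    have := mul_le_mul_of_nonneg_left h2 hG
    linarith
  · intro w hw
    refine le_antisymm (by simpa using hle w w hw) (le_ciInf fun w' => ?_)
    have := (abs_le.mp (hL w hw w' w'.2)).2
    linarith

end Convex

/-! ### Multiplicative weights along random signs -/

noncomputable section

section MultiplicativeWeights

open scoped InnerProductSpace

theorem EuclideanSpace.inner_eq_sum_mul {d : ℕ} (x y : EuclideanSpace ℝ (Fin d)) :
    ⟪x, y⟫_ℝ = ∑ r, x r * y r := by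
  rw [PiLp.inner_apply]
  exact Finset.sum_congr rfl fun r _ => by simp [mul_comm]

/-- The mean of the random sign vector with exponential tilt `θ`. -/
def tanhVec {d : ℕ} (θ : EuclideanSpace ℝ (Fin d)) : EuclideanSpace ℝ (Fin d) :=
  WithLp.toLp 2 fun r => Real.tanh (θ r)

theorem norm_tanhVec_le {d : ℕ} (θ : EuclideanSpace ℝ (Fin d)) : ‖tanhVec θ‖ ≤ ‖θ‖ := by
  rw [EuclideanSpace.norm_eq, EuclideanSpace.norm_eq]
  refine Real.sqrt_le_sqrt (Finset.sum_le_sum fun r _ => ?_)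
  exact pow_le_pow_left₀ (norm_nonneg _) abs_tanh_le 2

/-- The vector `c • v`, shrunk to the unit ball. -/
def clippedTilt {E : Type*} [NormedAddCommGroup E] [NormedSpace ℝ E] (c : ℝ) (v : E) : E :=
  (max 1 ‖c • v‖)⁻¹ • (c • v)

theorem norm_clippedTilt_le {E : Type*} [NormedAddCommGroup E] [NormedSpace ℝ E] (c : ℝ) (v : E) :
    ‖clippedTilt c v‖ ≤ 1 := by
  have h : 0 < max 1 ‖c • v‖ := lt_of_lt_of_le one_pos (le_max_left _ _)
  rw [clippedTilt, norm_smul, Real.norm_of_nonneg (inv_nonneg.mpr h.le), inv_mul_le_iff₀ h, mul_one]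
  exact le_max_right _ _

/-- The clipped tilt `t • v` has coordinates in `[-1, 1]`, so `half_sq_le_mul_tanh` bounds the
pairing below by `t * ‖v‖ ^ 2 / 2`. When clipping is active this is `‖v‖ / 2`; otherwise `‖v‖ ≤ 1 /
c` and the claimed lower bound is not positive. -/
theorem le_inner_tanhVec_clippedTilt {d : ℕ} {c : ℝ} (hc : 0 < c) (v : EuclideanSpace ℝ (Fin d)) :
    (‖v‖ - 1 / c) / 2 ≤ ⟪v, tanhVec (clippedTilt c v)⟫_ℝ := by
  set M := max 1 ‖c • v‖ with hM
  have hM1 : 1 ≤ M := le_max_left _ _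
  set t := M⁻¹ * c with ht
  have htpos : 0 < t := by positivity
  have hθ : ∀ r, clippedTilt c v r = t * v r := by
    intro r
    simp [clippedTilt, ← hM, ht, mul_assoc]
  have habs : ∀ r, |t * v r| ≤ 1 := by
    intro r
    rw [← hθ]
    exact (PiLp.norm_apply_le (clippedTilt c v) r).trans (norm_clippedTilt_le c v)
  have h1 : t * ‖v‖ ^ 2 / 2 ≤ ⟪v, tanhVec (clippedTilt c v)⟫_ℝ := by
    rw [EuclideanSpace.inner_eq_sum_mul, EuclideanSpace.real_norm_sq_eq, Finset.mul_sum,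
      Finset.sum_div]
    refine Finset.sum_le_sum fun r _ => ?_
    change t * v r ^ 2 / 2 ≤ v r * Real.tanh (clippedTilt c v r)
    rw [hθ]
    have := half_sq_le_mul_tanh (habs r)
    refine le_of_mul_le_mul_left ?_ htpos
    nlinarith
  refine le_trans ?_ h1
  have h2 : ‖c • v‖ = c * ‖v‖ := by rw [norm_smul, Real.norm_of_nonneg hc.le]
  have h3 : ‖v‖ - 1 / c ≤ t * ‖v‖ ^ 2 := by
    rcases le_total ‖c • v‖ 1 with h | h
    · rw [h2] at h
      have : ‖v‖ ≤ 1 / c := by rw [le_div_iff₀ hc]; linarith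
      have : 0 ≤ t * ‖v‖ ^ 2 := by positivity
      linarith
    · have hMe : M = c * ‖v‖ := by rw [hM, max_eq_right h, h2]
      have hv : 0 < ‖v‖ := by
        rw [h2] at h
        by_contra! hv
        nlinarith
      have : t * ‖v‖ ^ 2 = ‖v‖ := by
        rw [ht, hMe]
        field_simp
      rw [this]
      have : 0 < 1 / c := by positivity
      linarith
  linarith

/-- Jensen's inequality for `log`, through its tangent at `exp A`. -/
theorem sum_mul_log_le {ι : Type*} [Fintype ι] {p X : ι → ℝ} {A : ℝ} (hp : ∀ i, 0 ≤ p i)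
    (hp1 : ∑ i, p i = 1) (hX : ∀ i, 0 < X i) (h : ∑ i, p i * X i ≤ Real.exp A) :
    ∑ i, p i * Real.log (X i) ≤ A := by
  have key : ∀ i, Real.log (X i) ≤ A + X i * Real.exp (-A) - 1 := by
    intro i
    have := Real.log_le_sub_one_of_pos (mul_pos (hX i) (Real.exp_pos (-A)))
    rw [Real.log_mul (hX i).ne' (Real.exp_pos _).ne', Real.log_exp] at this
    linarith
  calc ∑ i, p i * Real.log (X i)
      ≤ ∑ i, (p i * (A - 1) + p i * X i * Real.exp (-A)) := by
        refine Finset.sum_le_sum fun i _ => ?_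
        have := mul_le_mul_of_nonneg_left (key i) (hp i)
        linarith
    _ = A - 1 + (∑ i, p i * X i) * Real.exp (-A) := by
        rw [Finset.sum_add_distrib, ← Finset.sum_mul, ← Finset.sum_mul, hp1, one_mul]
    _ ≤ A - 1 + Real.exp A * Real.exp (-A) := by gcongr
    _ = A := by rw [← Real.exp_add, add_neg_cancel, Real.exp_zero]; ring

variable {Y : Type*} [Fintype Y]

/-- The average negative log-likelihood of the data under the distributions with
log-weights `H`. -/
def weightsPotential {n : ℕ} (y : Fin n → Y) (H : Fin n → Y → ℝ) : ℝ :=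
  (1 / (n : ℝ)) * ∑ i, (Real.log (∑ a, Real.exp (H i a)) - H i (y i))

theorem weightsPotential_nonneg {n : ℕ} (y : Fin n → Y) (H : Fin n → Y → ℝ) :
    0 ≤ weightsPotential y H := by
  refine mul_nonneg (by positivity) (Finset.sum_nonneg fun i _ => sub_nonneg.mpr ?_)
  have : Nonempty Y := ⟨y i⟩
  rw [Real.le_log_iff_exp_le (sum_exp_pos _)]
  exact Finset.single_le_sum (f := fun a => Real.exp (H i a))
    (fun a _ => (Real.exp_pos _).le) (Finset.mem_univ (y i))

variable [Nonempty Y]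

/-- The expected change of the log-partition part of the potential in one multiplicative weights
update along a random sign vector. -/
theorem sum_softmax_mul_log_sum_le {d : ℕ} (H : Y → ℝ) {q : Y → EuclideanSpace ℝ (Fin d)}
    (hq : ∀ y, ‖q y‖ ≤ 1) (y₀ : Y) {θ : EuclideanSpace ℝ (Fin d)} (hθ : ‖θ‖ ≤ 1) {η : ℝ}
    (hη : 0 ≤ η) :
    ∑ V, softmax (signPairing fun r => θ r) V *
        (Real.log (∑ y, Real.exp (H y + η * signPairing (fun r => q y r) V))
          - (H y₀ + η * signPairing (fun r => q y₀ r) V))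
      ≤ Real.log (∑ y, Real.exp (H y)) - H y₀
        - η * ⟪q y₀ - ∑ y, softmax H y • q y, tanhVec θ⟫_ℝ + 4 * η ^ 2 := by
  set p := softmax (signPairing fun r => θ r)
  have hp : ∀ V, 0 < p V := softmax_pos _
  have hp1 : ∑ V, p V = 1 := sum_softmax _
  have hZ := sum_exp_pos H
  -- Centring at the true value `y₀` makes `log (X V)` exactly the increment of the negative
  -- log-likelihood.
  set c : Y → EuclideanSpace ℝ (Fin d) := fun y => η • (q y - q y₀) with hc
  set X : (Fin d → Bool) → ℝ := fun V =>
    ∑ y, softmax H y * Real.exp (signPairing (fun r => c y r) V) with hX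
  have hXpos : ∀ V, 0 < X V := fun V =>
    Finset.sum_pos (fun y _ => mul_pos (softmax_pos H y) (Real.exp_pos _)) Finset.univ_nonempty
  have hpair : ∀ y V, signPairing (fun r => c y r) V
      = η * signPairing (fun r => q y r) V - η * signPairing (fun r => q y₀ r) V := by
    intro y V
    simp only [signPairing, Finset.mul_sum, ← Finset.sum_sub_distrib]
    refine Finset.sum_congr rfl fun r _ => ?_
    simp only [hc, PiLp.smul_apply, PiLp.sub_apply, smul_eq_mul]
    ring
  have hlog : ∀ V, Real.log (∑ y, Real.exp (H y + η * signPairing (fun r => q y r) V))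
      = Real.log (∑ y, Real.exp (H y)) + η * signPairing (fun r => q y₀ r) V
        + Real.log (X V) := by
    intro V
    have : ∑ y, Real.exp (H y + η * signPairing (fun r => q y r) V)
        = (∑ y, Real.exp (H y)) * Real.exp (η * signPairing (fun r => q y₀ r) V) * X V := by
      rw [hX, Finset.mul_sum]
      refine Finset.sum_congr rfl fun y _ => ?_
      simp only [hpair, softmax, Real.exp_sub, Real.exp_add]
      have := (Real.exp_pos (η * signPairing (fun r => q y₀ r) V)).ne'
      field_simp
    rw [this, Real.log_mul (mul_pos hZ (Real.exp_pos _)).ne' (hXpos V).ne',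
      Real.log_mul hZ.ne' (Real.exp_pos _).ne', Real.log_exp]
  have hcn : ∀ y, ‖c y‖ ≤ 2 * η := by
    intro y
    rw [hc, norm_smul, Real.norm_of_nonneg hη, mul_comm]
    refine mul_le_mul_of_nonneg_right ((norm_sub_le _ _).trans ?_) hη
    linarith [hq y, hq y₀]
  have hinner : ∀ y, |⟪c y, tanhVec θ⟫_ℝ| ≤ 2 * η := by
    intro y
    refine (abs_real_inner_le_norm _ _).trans ?_
    have := mul_le_mul (hcn y) ((norm_tanhVec_le θ).trans hθ) (norm_nonneg _) (by positivity)
    linarith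
  have hmean : ∑ y, softmax H y * ⟪c y, tanhVec θ⟫_ℝ
      = -(η * ⟪q y₀ - ∑ y, softmax H y • q y, tanhVec θ⟫_ℝ) := by
    have e : ∑ y, softmax H y • (q y - q y₀) = ∑ y, softmax H y • q y - q y₀ := by
      simp only [smul_sub, Finset.sum_sub_distrib, ← Finset.sum_smul, sum_softmax, one_smul]
    calc ∑ y, softmax H y * ⟪c y, tanhVec θ⟫_ℝ
        = η * ⟪∑ y, softmax H y • (q y - q y₀), tanhVec θ⟫_ℝ := by
          rw [sum_inner, Finset.mul_sum]
          refine Finset.sum_congr rfl fun y _ => ?_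
          rw [hc, real_inner_smul_left, real_inner_smul_left]
          ring
      _ = _ := by
          rw [e, ← neg_sub, inner_neg_left]
          ring
  -- Two sub-Gaussian bounds, each costing `2 * η ^ 2`: over the signs `V` for fixed `y`, then over
  -- `y` under the current weights.
  have hbound : ∑ V, p V * X V
      ≤ Real.exp (-(η * ⟪q y₀ - ∑ y, softmax H y • q y, tanhVec θ⟫_ℝ) + 4 * η ^ 2) := by
    calc ∑ V, p V * X V
        = ∑ y, softmax H y * ∑ V, p V * Real.exp (signPairing (fun r => c y r) V) := by
          simp only [hX, Finset.mul_sum]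
          rw [Finset.sum_comm]
          exact Finset.sum_congr rfl fun y _ => Finset.sum_congr rfl fun V _ => by ring
      _ ≤ ∑ y, softmax H y * (Real.exp ⟪c y, tanhVec θ⟫_ℝ * Real.exp (2 * η ^ 2)) := by
          refine Finset.sum_le_sum fun y _ => mul_le_mul_of_nonneg_left ?_ (softmax_pos H y).le
          refine (sum_softmax_signPairing_mul_exp_le _ _).trans ?_
          rw [← Real.exp_add, EuclideanSpace.inner_eq_sum_mul, ← EuclideanSpace.real_norm_sq_eq]
          refine Real.exp_le_exp.mpr (add_le_add le_rfl ?_)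
          have := pow_le_pow_left₀ (norm_nonneg _) (hcn y) 2
          linarith
      _ = (∑ y, softmax H y * Real.exp ⟪c y, tanhVec θ⟫_ℝ) * Real.exp (2 * η ^ 2) := by
          rw [Finset.sum_mul]
          exact Finset.sum_congr rfl fun y _ => by ring
      _ ≤ Real.exp (∑ y, softmax H y * ⟪c y, tanhVec θ⟫_ℝ + (2 * η) ^ 2 / 2)
            * Real.exp (2 * η ^ 2) := by
          gcongr
          exact sum_mul_exp_le (fun y => (softmax_pos H y).le) (sum_softmax H) hinner
      _ = _ := by
          rw [← Real.exp_add, hmean]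
          congr 1
          ring
  have hfin := sum_mul_log_le (fun V => (hp V).le) hp1 hXpos hbound
  calc ∑ V, p V * (Real.log (∑ y, Real.exp (H y + η * signPairing (fun r => q y r) V))
          - (H y₀ + η * signPairing (fun r => q y₀ r) V))
      = ∑ V, (p V * (Real.log (∑ y, Real.exp (H y)) - H y₀) + p V * Real.log (X V)) := by
        refine Finset.sum_congr rfl fun V _ => ?_
        rw [hlog]
        ring
    _ = Real.log (∑ y, Real.exp (H y)) - H y₀ + ∑ V, p V * Real.log (X V) := by
        rw [Finset.sum_add_distrib, ← Finset.sum_mul, hp1, one_mul]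
    _ ≤ _ := by linarith

theorem sum_softmax_mul_weightsPotential_le {n d : ℕ} (hn : 1 ≤ n) (y : Fin n → Y)
    (H : Fin n → Y → ℝ) {q : Fin n → Y → EuclideanSpace ℝ (Fin d)} (hq : ∀ i a, ‖q i a‖ ≤ 1)
    {θ : EuclideanSpace ℝ (Fin d)} (hθ : ‖θ‖ ≤ 1) {η : ℝ} (hη : 0 ≤ η) :
    ∑ V, softmax (signPairing fun r => θ r) V *
        weightsPotential y (fun i a => H i a + η * signPairing (fun r => q i a r) V)
      ≤ weightsPotential y H
        - η * ⟪(1 / (n : ℝ)) • ∑ i, q i (y i)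
            - (1 / (n : ℝ)) • ∑ i, ∑ a, softmax (H i) a • q i a, tanhVec θ⟫_ℝ + 4 * η ^ 2 := by
  have hn' : (0 : ℝ) < n := by exact_mod_cast hn
  calc ∑ V, softmax (signPairing fun r => θ r) V *
        weightsPotential y (fun i a => H i a + η * signPairing (fun r => q i a r) V)
      = (1 / (n : ℝ)) * ∑ i, ∑ V, softmax (signPairing fun r => θ r) V *
          (Real.log (∑ a, Real.exp (H i a + η * signPairing (fun r => q i a r) V))
            - (H i (y i) + η * signPairing (fun r => q i (y i) r) V)) := by
        simp only [weightsPotential, Finset.mul_sum]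
        rw [Finset.sum_comm]
        exact Finset.sum_congr rfl fun i _ => Finset.sum_congr rfl fun V _ => by ring
    _ ≤ (1 / (n : ℝ)) * ∑ i, (Real.log (∑ a, Real.exp (H i a)) - H i (y i)
          - η * ⟪q i (y i) - ∑ a, softmax (H i) a • q i a, tanhVec θ⟫_ℝ + 4 * η ^ 2) := by
        gcongr with i
        exact sum_softmax_mul_log_sum_le (H i) (hq i) (y i) hθ hη
    _ = _ := by
        rw [← smul_sub, ← Finset.sum_sub_distrib, real_inner_smul_left, sum_inner,
          Finset.sum_add_distrib, Finset.sum_sub_distrib, Finset.sum_const, Finset.card_univ,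
          Fintype.card_fin, nsmul_eq_mul, ← Finset.mul_sum, weightsPotential]
        field_simp

end MultiplicativeWeights

end

/-! ### One round of the mechanism -/

noncomputable section

section Mechanism

open scoped InnerProductSpace

variable {m n : ℕ} {d : Fin m → ℕ} {Y : Type*} [Fintype Y]

/-- The state of the mechanism: log-weights of the synthetic distributions of the sensitive
features, and one iterate per loss. -/
abbrev MechState (n : ℕ) {m : ℕ} (d : Fin m → ℕ) (Y : Type*) : Type _ :=
  (Fin n → Y → ℝ) × ((j : Fin m) → EuclideanSpace ℝ (Fin (d j)))

/-- The outcome of one round: the index of a loss and a direction in its domain. -/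
abbrev MechOutcome {m : ℕ} (d : Fin m → ℕ) : Type :=
  Σ j : Fin m, (Fin (d j) → Bool)

variable (q : (j : Fin m) → EuclideanSpace ℝ (Fin (d j)) → Fin n → Y → EuclideanSpace ℝ (Fin (d j)))

/-- The average gradient under the synthetic distributions. -/
def synthGrad (s : MechState n d Y) (j : Fin m) : EuclideanSpace ℝ (Fin (d j)) :=
  (1 / (n : ℝ)) • ∑ i, ∑ a, softmax (s.1 i) a • q j (s.2 j) i a

/-- The average gradient on the data. -/
def dataGrad (y : Fin n → Y) (s : MechState n d Y) (j : Fin m) : EuclideanSpace ℝ (Fin (d j)) :=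
  (1 / (n : ℝ)) • ∑ i, q j (s.2 j) i (y i)

/-- The data enter a round only through this vector, in `stepProb`; `stepUpdate` does not see them.
-/
def gradGap (y : Fin n → Y) (s : MechState n d Y) (j : Fin m) : EuclideanSpace ℝ (Fin (d j)) :=
  dataGrad q y s j - synthGrad q s j

/-- The distribution of the outcome of one round. -/
def stepProb (c : ℝ) (y : Fin n → Y) (s : MechState n d Y) (a : MechOutcome d) : ℝ :=
  softmax (fun j => c * ‖gradGap q y s j‖) a.1 *
    softmax (signPairing fun r => clippedTilt c (gradGap q y s a.1) r) a.2

/-- One multiplicative weights update together with one projected gradient step. -/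
def stepUpdate (proj : (j : Fin m) → EuclideanSpace ℝ (Fin (d j)) → EuclideanSpace ℝ (Fin (d j)))
    (η γ : ℝ) (s : MechState n d Y) (a : MechOutcome d) : MechState n d Y :=
  (fun i b => s.1 i b + η * signPairing (fun r => q a.1 (s.2 a.1) i b r) a.2,
    fun j => proj j (s.2 j - γ • synthGrad q s j))

theorem stepProb_pos (c : ℝ) (y : Fin n → Y) (s : MechState n d Y) (a : MechOutcome d) :
    0 < stepProb q c y s a :=
  mul_pos (softmax_pos _ _) (softmax_pos _ _)

theorem sum_stepProb_mul (c : ℝ) (y : Fin n → Y) (s : MechState n d Y) (f : MechOutcome d → ℝ) :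
    ∑ a, stepProb q c y s a * f a = ∑ j, softmax (fun j => c * ‖gradGap q y s j‖) j *
      ∑ V, softmax (signPairing fun r => clippedTilt c (gradGap q y s j) r) V * f ⟨j, V⟩ := by
  rw [Fintype.sum_sigma]
  refine Finset.sum_congr rfl fun j _ => ?_
  rw [Finset.mul_sum]
  exact Finset.sum_congr rfl fun V _ => by rw [stepProb, mul_assoc]

theorem sum_stepProb (hm : 1 ≤ m) (c : ℝ) (y : Fin n → Y) (s : MechState n d Y) :
    ∑ a, stepProb q c y s a = 1 := by
  have : Nonempty (Fin m) := ⟨⟨0, hm⟩⟩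
  have h := sum_stepProb_mul q c y s fun _ => 1
  simpa only [mul_one, sum_softmax] using h

variable {q}

/-- The synthetic part cancels, and only one of the `n` averaged unit-ball vectors changes. -/
theorem norm_gradGap_sub_le (hn : 1 ≤ n) (hq : ∀ j w i a, ‖q j w i a‖ ≤ 1) {y y' : Fin n → Y}
    {i₀ : Fin n} (hy : ∀ i, i ≠ i₀ → y i = y' i) (s : MechState n d Y) (j : Fin m) :
    ‖gradGap q y s j - gradGap q y' s j‖ ≤ 2 / n := by
  have hn' : (0 : ℝ) < n := by exact_mod_cast hn
  have e : gradGap q y s j - gradGap q y' s j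
      = (1 / (n : ℝ)) • (q j (s.2 j) i₀ (y i₀) - q j (s.2 j) i₀ (y' i₀)) := by
    rw [gradGap, gradGap, sub_sub_sub_cancel_right, dataGrad, dataGrad, ← smul_sub,
      ← Finset.sum_sub_distrib]
    congr 1
    refine Finset.sum_eq_single i₀ (fun i _ hi => ?_) (by simp)
    rw [hy i hi, sub_self]
  rw [e, norm_smul, Real.norm_of_nonneg (by positivity), div_mul_eq_mul_div, one_mul]
  gcongr
  refine (norm_sub_le _ _).trans ?_
  linarith [hq j (s.2 j) i₀ (y i₀), hq j (s.2 j) i₀ (y' i₀)]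

/-- Privacy of one round. -/
theorem renyiMoment_stepProb_le (hm : 1 ≤ m) (hn : 1 ≤ n) (hq : ∀ j w i a, ‖q j w i a‖ ≤ 1)
    {c r : ℝ} (hc : 0 ≤ c) (hr : 0 ≤ r) {y y' : Fin n → Y}
    {i₀ : Fin n} (hy : ∀ i, i ≠ i₀ → y i = y' i) (s : MechState n d Y) :
    renyiMoment r (stepProb q c y s) (stepProb q c y' s)
      ≤ Real.exp (10 * c ^ 2 / n ^ 2 * (r * (r + 1))) := by
  have : Nonempty (Fin m) := ⟨⟨0, hm⟩⟩
  have h1 : renyiMoment r (softmax fun j => c * ‖gradGap q y s j‖)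
      (softmax fun j => c * ‖gradGap q y' s j‖)
      ≤ Real.exp ((c * (2 / n)) ^ 2 * (r * (r + 1)) / 2) := by
    refine renyiMoment_softmax_le_of_abs_sub_le hr fun j => ?_
    rw [← mul_sub, abs_mul, abs_of_nonneg hc]
    refine mul_le_mul_of_nonneg_left ?_ hc
    exact (abs_norm_sub_norm_le _ _).trans (norm_gradGap_sub_le hn hq hy s j)
  have h2 : ∀ j, renyiMoment r
      (softmax (signPairing fun r => clippedTilt c (gradGap q y s j) r))
      (softmax (signPairing fun r => clippedTilt c (gradGap q y' s j) r))
      ≤ Real.exp ((2 * (c * (2 / n))) ^ 2 * (r * (r + 1)) / 2) := by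
    intro j
    refine renyiMoment_signPairing_le _ _ hr ?_
    have h3 : ‖clippedTilt c (gradGap q y s j) - clippedTilt c (gradGap q y' s j)‖
        ≤ 2 * (c * (2 / n)) := by
      refine (norm_smul_sub_smul_le _ _).trans ?_
      rw [← smul_sub, norm_smul, Real.norm_of_nonneg hc]
      have := norm_gradGap_sub_le hn hq hy s j
      gcongr
    refine le_trans (le_of_eq ?_) (pow_le_pow_left₀ (norm_nonneg _) h3 2)
    rw [EuclideanSpace.real_norm_sq_eq]
    rfl
  refine (renyiMoment_sigma_le (fun j => (softmax_pos _ j).le) (fun j => (softmax_pos _ j).le)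
    (fun j V => (softmax_pos _ V).le) (fun j V => (softmax_pos _ V).le) h1 h2
    (Real.exp_pos _).le).trans (le_of_eq ?_)
  rw [← Real.exp_add]
  congr 1
  ring

/-- Decrease of the potential in one round. -/
theorem step_potential_le [Nonempty Y] (hm : 1 ≤ m) (hn : 1 ≤ n)
    (hq : ∀ j w i a, ‖q j w i a‖ ≤ 1)
    {K : (j : Fin m) → Set (EuclideanSpace ℝ (Fin (d j)))} {R : ℝ}
    (hKR : ∀ j, K j ⊆ Metric.closedBall 0 R)
    {proj : (j : Fin m) → EuclideanSpace ℝ (Fin (d j)) → EuclideanSpace ℝ (Fin (d j))}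
    (hproj : ∀ j x, ∀ z ∈ K j, ‖proj j x - z‖ ≤ ‖x - z‖)
    {c η γ : ℝ} (hc : 0 < c) (hη : 0 < η) (hγ : 0 < γ) (y : Fin n → Y) (j : Fin m)
    {z : EuclideanSpace ℝ (Fin (d j))} (hz : z ∈ K j) {s : MechState n d Y} (hs : s.2 j ∈ K j) :
    ⟪dataGrad q y s j, s.2 j - z⟫_ℝ + ∑ a, stepProb q c y s a *
        (‖(stepUpdate q proj η γ s a).2 j - z‖ ^ 2 / (2 * γ)
          + 4 * R / η * weightsPotential y (stepUpdate q proj η γ s a).1)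
      ≤ ‖s.2 j - z‖ ^ 2 / (2 * γ) + 4 * R / η * weightsPotential y s.1
        + (γ / 2 + 2 * R * ((1 + Real.log m) / c + 8 * η)) := by
  have : Nonempty (Fin m) := ⟨⟨0, hm⟩⟩
  have hn' : (0 : ℝ) < n := by exact_mod_cast hn
  have hzR : ‖z‖ ≤ R := by simpa using hKR j hz
  have hR : 0 ≤ R := (norm_nonneg z).trans hzR
  have hdiam : ‖s.2 j - z‖ ≤ 2 * R := by
    have : ‖s.2 j‖ ≤ R := by simpa using hKR j hs
    exact (norm_sub_le _ _).trans (by linarith)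
  set g := synthGrad q s j with hg
  have hg1 : ‖g‖ ≤ 1 := by
    have h1 : ∀ i, ‖∑ a, softmax (s.1 i) a • q j (s.2 j) i a‖ ≤ 1 := by
      intro i
      calc ‖∑ a, softmax (s.1 i) a • q j (s.2 j) i a‖
          ≤ ∑ a, ‖softmax (s.1 i) a • q j (s.2 j) i a‖ := norm_sum_le _ _
        _ ≤ ∑ a, softmax (s.1 i) a := by
            refine Finset.sum_le_sum fun a _ => ?_
            rw [norm_smul, Real.norm_of_nonneg (softmax_pos _ _).le]
            exact mul_le_of_le_one_right (softmax_pos _ _).le (hq _ _ _ _)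
        _ = 1 := sum_softmax _
    rw [hg, synthGrad, norm_smul, Real.norm_of_nonneg (by positivity), div_mul_eq_mul_div, one_mul,
      div_le_one hn']
    refine (norm_sum_le _ _).trans ((Finset.sum_le_sum fun i _ => h1 i).trans ?_)
    simp
  -- The usual projected gradient inequality, for the synthetic gradient.
  have hgd : ⟪g, s.2 j - z⟫_ℝ + ‖proj j (s.2 j - γ • g) - z‖ ^ 2 / (2 * γ)
      ≤ ‖s.2 j - z‖ ^ 2 / (2 * γ) + γ / 2 := by
    have h1 := pow_le_pow_left₀ (norm_nonneg _) (hproj j (s.2 j - γ • g) z hz) 2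
    have h2 : ‖s.2 j - γ • g - z‖ ^ 2
        = ‖s.2 j - z‖ ^ 2 - 2 * γ * ⟪g, s.2 j - z⟫_ℝ + γ ^ 2 * ‖g‖ ^ 2 := by
      rw [show s.2 j - γ • g - z = (s.2 j - z) - γ • g by abel, norm_sub_sq_real,
        real_inner_smul_right, real_inner_comm, norm_smul, Real.norm_of_nonneg hγ.le]
      ring
    have h3 : ‖g‖ ^ 2 ≤ 1 := pow_le_one₀ (norm_nonneg _) hg1
    have h4 : γ ^ 2 * ‖g‖ ^ 2 ≤ γ ^ 2 := mul_le_of_le_one_right (sq_nonneg γ) h3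
    rw [← le_sub_iff_add_le', div_le_iff₀ (by positivity)]
    have h5 : (‖s.2 j - z‖ ^ 2 / (2 * γ) + γ / 2 - ⟪g, s.2 j - z⟫_ℝ) * (2 * γ)
        = ‖s.2 j - z‖ ^ 2 + γ ^ 2 - 2 * γ * ⟪g, s.2 j - z⟫_ℝ := by
      field_simp
    rw [h5]
    linarith
  -- The gap of every `j` is at most the expected selected gap plus `log m / c`, so one update per
  -- round serves all losses.
  have hsel := le_sum_softmax_mul_add (fun j => ‖gradGap q y s j‖) hc j
  rw [Fintype.card_fin] at hsel
  have hin : ⟪gradGap q y s j, s.2 j - z⟫_ℝ ≤ 2 * R * ‖gradGap q y s j‖ := by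
    refine (real_inner_le_norm _ _).trans ?_
    rw [mul_comm]
    exact mul_le_mul_of_nonneg_right hdiam (norm_nonneg _)
  have hsplit : ⟪dataGrad q y s j, s.2 j - z⟫_ℝ
      = ⟪gradGap q y s j, s.2 j - z⟫_ℝ + ⟪g, s.2 j - z⟫_ℝ := by
    rw [← inner_add_left, gradGap, sub_add_cancel]
  set P := softmax fun j => c * ‖gradGap q y s j‖ with hP
  have hP1 : ∑ j, P j = 1 := sum_softmax _
  have hmw : ∀ j', ∑ V, softmax (signPairing fun r => clippedTilt c (gradGap q y s j') r) V *
      weightsPotential y (stepUpdate q proj η γ s ⟨j', V⟩).1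
      ≤ weightsPotential y s.1 - η * ((‖gradGap q y s j'‖ - 1 / c) / 2) + 4 * η ^ 2 := by
    intro j'
    refine (sum_softmax_mul_weightsPotential_le hn y s.1 (fun i a => hq j' (s.2 j') i a)
      (norm_clippedTilt_le c (gradGap q y s j')) hη.le).trans ?_
    have := mul_le_mul_of_nonneg_left (le_inner_tanhVec_clippedTilt hc (gradGap q y s j')) hη.le
    change _ - η * ⟪gradGap q y s j', _⟫_ℝ + _ ≤ _
    linarith
  have hpot : ∑ a, stepProb q c y s a * weightsPotential y (stepUpdate q proj η γ s a).1
      ≤ weightsPotential y s.1 - η / 2 * ∑ j', P j' * ‖gradGap q y s j'‖ + η / 2 * (1 / c)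
        + 4 * η ^ 2 := by
    rw [sum_stepProb_mul]
    calc _ ≤ ∑ j', P j' * (weightsPotential y s.1
          - η * ((‖gradGap q y s j'‖ - 1 / c) / 2) + 4 * η ^ 2) :=
          Finset.sum_le_sum fun j' _ => mul_le_mul_of_nonneg_left (hmw j') (softmax_pos _ _).le
      _ = ∑ j', (P j' * (weightsPotential y s.1 + η / 2 * (1 / c) + 4 * η ^ 2)
            - η / 2 * (P j' * ‖gradGap q y s j'‖)) :=
          Finset.sum_congr rfl fun j' _ => by ring
      _ = _ := by
          rw [Finset.sum_sub_distrib, ← Finset.sum_mul, hP1, ← Finset.mul_sum]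
          ring
  have hsum : ∑ a, stepProb q c y s a *
        (‖(stepUpdate q proj η γ s a).2 j - z‖ ^ 2 / (2 * γ)
          + 4 * R / η * weightsPotential y (stepUpdate q proj η γ s a).1)
      = ‖proj j (s.2 j - γ • g) - z‖ ^ 2 / (2 * γ) + 4 * R / η *
        ∑ a, stepProb q c y s a * weightsPotential y (stepUpdate q proj η γ s a).1 := by
    simp only [mul_add, Finset.sum_add_distrib]
    congr 1
    · change ∑ a, stepProb q c y s a * (‖proj j (s.2 j - γ • g) - z‖ ^ 2 / (2 * γ)) = _
      rw [← Finset.sum_mul, sum_stepProb q hm, one_mul]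
    · rw [Finset.mul_sum]
      exact Finset.sum_congr rfl fun a _ => by ring
  -- The weight `4 * R / η` turns the expected drop `η / 2` times the gap into `2 * R` times the
  -- gap, which pays for the error in `hin`.
  have hpot' := mul_le_mul_of_nonneg_left hpot (show 0 ≤ 4 * R / η by positivity)
  have e : 4 * R / η * (weightsPotential y s.1 - η / 2 * ∑ j', P j' * ‖gradGap q y s j'‖
        + η / 2 * (1 / c) + 4 * η ^ 2)
      = 4 * R / η * weightsPotential y s.1 - 2 * R * ∑ j', P j' * ‖gradGap q y s j'‖
        + 2 * R * (1 / c + 8 * η) := by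
    field_simp
    ring
  rw [e] at hpot'
  have hsel' := mul_le_mul_of_nonneg_left hsel (show 0 ≤ 2 * R by positivity)
  rw [hsum, hsplit, add_div]
  linarith

end Mechanism

end

/-! ### The iterated mechanism: privacy and regret -/

section PathMechanism

open scoped InnerProductSpace

/-- For every sensitive dataset there is a distribution on finitely many sequences of iterates,
stable under the change of one example, under which the average linearized regret on the data
is small in expectation. -/
theorem exists_path_mechanism {m n : ℕ} (hm : 1 ≤ m) (hn : 1 ≤ n) {d : Fin m → ℕ} {Y : Type*}
    [Fintype Y] (hY : 2 ≤ Fintype.card Y)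
    {q : (j : Fin m) → EuclideanSpace ℝ (Fin (d j)) → Fin n → Y → EuclideanSpace ℝ (Fin (d j))}
    (hq : ∀ j w i a, ‖q j w i a‖ ≤ 1)
    {K : (j : Fin m) → Set (EuclideanSpace ℝ (Fin (d j)))} {R : ℝ} (hR : 0 < R)
    (hKne : ∀ j, (K j).Nonempty) (hKc : ∀ j, IsClosed (K j)) (hKconv : ∀ j, Convex ℝ (K j))
    (hKR : ∀ j, K j ⊆ Metric.closedBall 0 R) {T : ℕ} (hT : 1 ≤ T) {ε δ : ℝ} (hδ : 0 < δ)
    (hε : 0 < ε) (hεδ : ε ≤ Real.log (1 / δ)) :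
    ∃ (P : (Fin n → Y) → (Fin T → MechOutcome d) → ℝ)
      (w : (Fin T → MechOutcome d) → Fin T → (j : Fin m) → EuclideanSpace ℝ (Fin (d j))),
      (∀ y ω, 0 < P y ω) ∧ (∀ y, ∑ ω, P y ω = 1) ∧
      (∀ y y' i₀, (∀ i, i ≠ i₀ → y i = y' i) → ∀ S : Finset (Fin T → MechOutcome d),
        ∑ ω ∈ S, P y ω ≤ Real.exp ε * ∑ ω ∈ S, P y' ω + δ) ∧
      (∀ ω t j, w ω t j ∈ K j) ∧
      ∀ y j, ∀ z ∈ K j, ∑ ω, P y ω *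
          ∑ t, ⟪(1 / (n : ℝ)) • ∑ i, q j (w ω t j) i (y i), w ω t j - z⟫_ℝ
        ≤ 2 * R * √T + 20 * R * √(T * Real.log (Fintype.card Y))
          + 2 * R * T * (1 + Real.log m) * √(60 * T * Real.log (1 / δ)) / (ε * n) := by
  have : Nonempty Y := Fintype.card_pos_iff.mp (by omega)
  have hn' : (0 : ℝ) < n := by exact_mod_cast hn
  have hT' : (0 : ℝ) < T := by exact_mod_cast hT
  set k := Fintype.card Y with hk
  have hlogk : 0 < Real.log k := Real.log_pos (by exact_mod_cast hY)
  set L := Real.log (1 / δ) with hL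
  have hLpos : 0 < L := hε.trans_le hεδ
  choose! proj hprojK hproj using fun j x =>
    exists_projection (hKne j) (hKc j).isComplete (hKconv j) x
  choose w₀ hw₀ using hKne
  -- The privacy budget: `10 * T * c ^ 2 / n ^ 2 = ε ^ 2 / (6 * L)`. Below, `η` balances `log k / η`
  -- against `T * η`, and `γ` balances `R ^ 2 / γ` against `T * γ`.
  set c : ℝ := ε * n / √(60 * T * L) with hc
  have hcpos : 0 < c := by positivity
  set η : ℝ := √(Real.log k / T) with hη
  have hηpos : 0 < η := by positivity
  set γ : ℝ := 2 * R / √T with hγ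
  have hγpos : 0 < γ := by positivity
  set u := stepUpdate q proj η γ with hu
  set s₀ : MechState n d Y := (fun _ _ => 0, w₀) with hs₀
  set I : Set (MechState n d Y) := {s | ∀ j, s.2 j ∈ K j} with hI
  have hIu : ∀ s ∈ I, ∀ a, u s a ∈ I := fun s _ a j => hprojK j _
  have hsI : s₀ ∈ I := hw₀
  refine ⟨fun y => pathProb (stepProb q c y) u T s₀, fun ω t => (pathState u T s₀ ω t).2,
    fun y ω => pathProb_pos (stepProb_pos q c y) u T s₀ ω,
    fun y => sum_pathProb (sum_stepProb q hm c y) u T s₀, ?_,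
    fun ω t j => pathState_mem hIu T s₀ hsI ω t j, ?_⟩
  · intro y y' i₀ hy S
    have hr : 0 ≤ 2 * L / ε := by positivity
    -- For this order the target `δ * exp (r * ε)` is `exp L`, while the composed exponent is `(2 *
    -- L + ε) / 3`, at most `L` because `ε ≤ L`.
    refine sum_le_of_renyiMoment_le (r := 2 * L / ε) hr
      (pathProb_pos (stepProb_pos q c y) u T s₀) (pathProb_pos (stepProb_pos q c y') u T s₀) ?_ S
    refine (renyiMoment_pathProb_le (stepProb_pos q c y) (stepProb_pos q c y') u
      (Real.exp_pos _).le (fun s => renyiMoment_stepProb_le hm hn hq hcpos.le hr hy s) T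
      s₀).trans ?_
    have hδe : δ = Real.exp (-L) := by
      rw [hL, one_div, Real.log_inv, neg_neg, Real.exp_log hδ]
    rw [← Real.exp_nat_mul, hδe, ← Real.exp_add]
    refine Real.exp_le_exp.mpr ?_
    have hsq : c ^ 2 = ε ^ 2 * n ^ 2 / (60 * T * L) := by
      rw [hc, div_pow, Real.sq_sqrt (by positivity), mul_pow]
    have e1 : (T : ℝ) * (10 * c ^ 2 / n ^ 2 * (2 * L / ε * (2 * L / ε + 1)))
        = (2 * L + ε) / 3 := by
      rw [hsq]
      field_simp
      ring
    have e2 : 2 * L / ε * ε = 2 * L := by field_simp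
    rw [e1, e2]
    linarith
  · intro y j z hz
    have hΨ : ∀ s : MechState n d Y,
        0 ≤ ‖s.2 j - z‖ ^ 2 / (2 * γ) + 4 * R / η * weightsPotential y s.1 := fun s =>
      add_nonneg (by positivity) (mul_nonneg (by positivity) (weightsPotential_nonneg y s.1))
    have hmain := sum_pathProb_mul_sum_le (stepProb_pos q c y) (sum_stepProb q hm c y) hIu
      (c := fun s => ⟪dataGrad q y s j, s.2 j - z⟫_ℝ) hΨ
      (fun s hs => step_potential_le hm hn hq hKR hproj hcpos hηpos hγpos y j hz (hs j)) T s₀ hsI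
    refine hmain.trans ?_
    have hw0 : ‖s₀.2 j - z‖ ^ 2 / (2 * γ) ≤ R * √T := by
      have h1 : ‖w₀ j‖ ≤ R := by simpa using hKR j (hw₀ j)
      have h2 : ‖z‖ ≤ R := by simpa using hKR j hz
      have h3 : ‖w₀ j - z‖ ≤ 2 * R := (norm_sub_le _ _).trans (by linarith)
      have h4 := pow_le_pow_left₀ (norm_nonneg _) h3 2
      rw [div_le_iff₀ (by positivity)]
      have : R * √T * (2 * γ) = (2 * R) ^ 2 := by
        rw [hγ]
        field_simp
      rw [this]
      exact h4
    have hpot : weightsPotential y s₀.1 = Real.log k := by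
      simp only [weightsPotential, hs₀, Real.exp_zero, Finset.sum_const, Finset.card_univ,
        nsmul_eq_mul, mul_one, sub_zero, Fintype.card_fin, ← hk]
      field_simp
    have hTη : T * η = √(T * Real.log k) := by
      rw [hη, Real.sqrt_div' _ hT'.le, Real.sqrt_mul' _ hlogk.le]
      have := Real.mul_self_sqrt hT'.le
      have h0 : 0 < √(T : ℝ) := by positivity
      field_simp
      nlinarith
    have hlogη : Real.log k / η = √(T * Real.log k) := by
      have h1 : η * η = Real.log k / T := Real.mul_self_sqrt (by positivity)
      rw [← hTη, div_eq_iff hηpos.ne', mul_assoc, h1]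
      field_simp
    have hγT : T * (γ / 2) = R * √T := by
      have := Real.mul_self_sqrt hT'.le
      have h0 : 0 < √(T : ℝ) := by positivity
      rw [hγ]
      field_simp
      nlinarith
    have e1 : 4 * R / η * Real.log k = 4 * R * √(T * Real.log k) := by
      rw [← hlogη]
      ring
    have e2 : T * (γ / 2 + 2 * R * ((1 + Real.log m) / c + 8 * η))
        = R * √T + 2 * R * T * (1 + Real.log m) * √(60 * T * L) / (ε * n)
          + 16 * R * √(T * Real.log k) := by
      rw [mul_add, hγT, ← hTη, hc]
      field_simp
      ring
    rw [hpot, e1, e2]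
    linarith

end PathMechanism

/-! ### Finite distributions as mechanisms -/

section FiniteMechanisms

/-- A finitely supported probability distribution as a measure. -/
theorem exists_probabilityMeasure_of_weights {Ω X : Type*} [Fintype Ω] [MeasurableSpace X]
    [MeasurableSingletonClass X] {p : Ω → ℝ} (hp : ∀ ω, 0 ≤ p ω) (hp1 : ∑ ω, p ω = 1)
    (out : Ω → X) :
    ∃ μ : ProbabilityMeasure X,
      (∀ S, MeasurableSet S → (μ : Measure X).real S = ∑ ω, p ω * S.indicator 1 (out ω)) ∧
      ∀ f : X → ℝ, Integrable f (μ : Measure X) ∧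
        ∫ x, f x ∂(μ : Measure X) = ∑ ω, p ω * f (out ω) := by
  set μ : Measure X := ∑ ω, ENNReal.ofReal (p ω) • Measure.dirac (out ω) with hμ
  have hprob : IsProbabilityMeasure μ := by
    constructor
    rw [hμ, Measure.finsetSum_apply]
    simp only [Measure.smul_apply, measure_univ, smul_eq_mul, mul_one]
    rw [← ENNReal.ofReal_sum_of_nonneg (fun i _ => hp i), hp1, ENNReal.ofReal_one]
  have hint : ∀ (f : X → ℝ) (ω : Ω),
      Integrable f (ENNReal.ofReal (p ω) • Measure.dirac (out ω)) := fun f ω =>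
    (integrable_dirac (by simp)).smul_measure ENNReal.ofReal_ne_top
  have hI : ∀ f : X → ℝ, Integrable f μ ∧ ∫ x, f x ∂μ = ∑ ω, p ω * f (out ω) := by
    intro f
    refine ⟨integrable_finsetSum_measure.mpr fun ω _ => hint f ω, ?_⟩
    rw [hμ, integral_finsetSum_measure fun ω _ => hint f ω]
    refine Finset.sum_congr rfl fun ω _ => ?_
    rw [integral_smul_measure, integral_dirac, ENNReal.toReal_ofReal (hp ω), smul_eq_mul]
  refine ⟨⟨μ, hprob⟩, fun S hS => ?_, hI⟩
  change μ.real S = _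
  rw [← integral_indicator_one hS]
  exact (hI _).2

/-- A family of finitely supported distributions, stable under the change of one sensitive
feature, as a family of measures. -/
theorem exists_mechanism_of_weights {ι Y Ω X : Type*} [Fintype Ω] [MeasurableSpace X]
    [MeasurableSingletonClass X] {P : (ι → Y) → Ω → ℝ} (hP : ∀ y ω, 0 ≤ P y ω)
    (hP1 : ∀ y, ∑ ω, P y ω = 1) {ε δ : ℝ}
    (hdp : ∀ y y' i₀, (∀ i, i ≠ i₀ → y i = y' i) → ∀ S : Finset Ω,
      ∑ ω ∈ S, P y ω ≤ Real.exp ε * ∑ ω ∈ S, P y' ω + δ) (out : Ω → X) :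
    ∃ A : (ι → Y) → ProbabilityMeasure X,
      (∀ y y' i₀, (∀ i, i ≠ i₀ → y i = y' i) → ∀ S, MeasurableSet S →
        (A y : Measure X).real S ≤ Real.exp ε * (A y' : Measure X).real S + δ) ∧
      ∀ y, ∀ f : X → ℝ, Integrable f (A y : Measure X) ∧
        ∫ x, f x ∂(A y : Measure X) = ∑ ω, P y ω * f (out ω) := by
  classical
  choose A hA1 hA2 using fun y => exists_probabilityMeasure_of_weights (hP y) (hP1 y) out
  refine ⟨A, fun y y' i₀ hy S hS => ?_, hA2⟩
  have e : ∀ y, ∑ ω, P y ω * S.indicator 1 (out ω) = ∑ ω with out ω ∈ S, P y ω := by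
    intro y
    rw [Finset.sum_filter]
    refine Finset.sum_congr rfl fun ω _ => ?_
    by_cases h : out ω ∈ S <;> simp [h]
  rw [hA1 y S hS, hA1 y' S hS, e, e]
  exact hdp y y' i₀ hy _

/-- Semi-sensitive mechanisms may be constructed separately for each choice of the non-sensitive
features. -/
theorem exists_isSemiSensitiveDP_of_forall_public {Xpub Xpriv Ω : Type*} {n : ℕ}
    [MeasurableSpace Ω] {ε δ : ℝ} {Q : Dataset Xpub Xpriv n → ProbabilityMeasure Ω → Prop}
    (h : ∀ x : Fin n → Xpub, ∃ A : (Fin n → Xpriv) → ProbabilityMeasure Ω,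
      (∀ y y' i₀, (∀ i, i ≠ i₀ → y i = y' i) → ∀ S, MeasurableSet S →
        (A y : Measure Ω).real S ≤ Real.exp ε * (A y' : Measure Ω).real S + δ) ∧
      ∀ y, Q (fun i => (x i, y i)) (A y)) :
    ∃ A : Dataset Xpub Xpriv n → ProbabilityMeasure Ω, IsSemiSensitiveDP ε δ A ∧
      ∀ D, Q D (A D) := by
  choose A hA hQ using h
  refine ⟨fun D => A (fun i => (D i).1) fun i => (D i).2, ?_,
    fun D => hQ (fun i => (D i).1) fun i => (D i).2⟩
  rintro D D' ⟨hpub, i₀, hi₀⟩ S hS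
  have e : (fun i => (D i).1) = fun i => (D' i).1 := funext hpub
  simp only [e]
  exact hA _ _ _ i₀ hi₀ S hS

end FiniteMechanisms

/-! ### Excess empirical risk -/

section ExcessRisk

variable {E X : Type*} {n : ℕ} {W : Set E} {ℓ : E → X → ℝ}

theorem excessRisk_le (hne : W.Nonempty) {D : Fin n → X} {w : E} {b : ℝ}
    (h : ∀ w' ∈ W, empiricalRisk ℓ D w ≤ empiricalRisk ℓ D w' + b) : excessRisk W ℓ D w ≤ b := by
  have : Nonempty W := hne.to_subtype
  rw [excessRisk, sub_le_comm]
  exact le_ciInf fun w' => by linarith [h w' w'.2]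

/-- The comparator is fixed before averaging, so a regret bound uniform in `w'` passes to the
infimum, which need not be attained. -/
theorem sum_mul_excessRisk_le {Ω : Type*} [Fintype Ω] {p : Ω → ℝ} (hp1 : ∑ ω, p ω = 1)
    (hne : W.Nonempty) {D : Fin n → X} {out : Ω → E} {b : ℝ}
    (h : ∀ w' ∈ W, ∑ ω, p ω * (empiricalRisk ℓ D (out ω) - empiricalRisk ℓ D w') ≤ b) :
    ∑ ω, p ω * excessRisk W ℓ D (out ω) ≤ b := by
  have : Nonempty W := hne.to_subtype
  have e : ∀ v, ∑ ω, p ω * (empiricalRisk ℓ D (out ω) - v)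
      = ∑ ω, p ω * empiricalRisk ℓ D (out ω) - v := by
    intro v
    simp only [mul_sub, Finset.sum_sub_distrib, ← Finset.sum_mul, hp1, one_mul]
  simp only [excessRisk, e] at h ⊢
  rw [sub_le_comm]
  exact le_ciInf fun w' => by linarith [h w' w'.2]

theorem exists_excessRisk_le (hne : W.Nonempty) (D : Fin n → X) {τ : ℝ} (hτ : 0 < τ) : ∃ w ∈ W, excessRisk W ℓ D w ≤ τ := by
  have : Nonempty W := hne.to_subtype
  obtain ⟨w, hw⟩ := exists_lt_of_ciInf_lt
    (show ⨅ w' : W, empiricalRisk ℓ D (w' : E) < (⨅ w' : W, empiricalRisk ℓ D (w' : E)) + τ by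
      linarith)
  exact ⟨w, w.2, by rw [excessRisk]; linarith⟩

variable [NormedAddCommGroup E] [NormedSpace ℝ E] {G : ℝ}

theorem empiricalRisk_sub_le (hn : 1 ≤ n) (hℓ : IsConvexLipschitzLoss W G ℓ) (D : Fin n → X)
    {w w' : E} (hw : w ∈ W) (hw' : w' ∈ W) :
    empiricalRisk ℓ D w ≤ empiricalRisk ℓ D w' + G * ‖w - w'‖ := by
  have hn' : (0 : ℝ) < n := by exact_mod_cast hn
  calc empiricalRisk ℓ D w
      ≤ (1 / (n : ℝ)) * ∑ i, (ℓ w' (D i) + G * ‖w - w'‖) := by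
        refine mul_le_mul_of_nonneg_left (Finset.sum_le_sum fun i _ => ?_) (by positivity)
        linarith [(abs_le.mp (hℓ.lipschitz (D i) w hw w' hw')).2]
    _ = _ := by
        rw [Finset.sum_add_distrib, Finset.sum_const, Finset.card_univ, Fintype.card_fin,
          nsmul_eq_mul, empiricalRisk]
        field_simp

theorem excessRisk_le_of_subset_closedBall (hn : 1 ≤ n) (hG : 0 ≤ G)
    (hℓ : IsConvexLipschitzLoss W G ℓ) {R : ℝ} (hW : W ⊆ Metric.closedBall 0 R) (D : Fin n → X)
    {w : E} (hw : w ∈ W) : excessRisk W ℓ D w ≤ 2 * (R * G) := by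
  refine excessRisk_le ⟨w, hw⟩ fun w' hw' => ?_
  have h1 : ‖w‖ ≤ R := by simpa using hW hw
  have h2 : ‖w'‖ ≤ R := by simpa using hW hw'
  have h3 : ‖w - w'‖ ≤ 2 * R := (norm_sub_le _ _).trans (by linarith)
  have := empiricalRisk_sub_le hn hℓ D hw hw'
  nlinarith [mul_le_mul_of_nonneg_left h3 hG]

end ExcessRisk

/-! ### The three mechanisms -/

section Mechanisms

/-- There is a mechanism that is private in the sensitive features `y`, with expected excess risk
at most `b` for each of the losses on the examples `e i (y i)`. -/
def HasPrivateMechanism {m n : ℕ} {d : Fin m → ℕ} {X Y : Type*}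
    (W : (j : Fin m) → Set (EuclideanSpace ℝ (Fin (d j))))
    (ℓ : (j : Fin m) → EuclideanSpace ℝ (Fin (d j)) → X → ℝ) (ε δ : ℝ) (e : Fin n → Y → X)
    (b : ℝ) : Prop :=
  ∃ A : (Fin n → Y) → ProbabilityMeasure ((j : Fin m) → W j),
    (∀ y y' i₀, (∀ i, i ≠ i₀ → y i = y' i) → ∀ S, MeasurableSet S →
      (A y : Measure ((j : Fin m) → W j)).real S
        ≤ Real.exp ε * (A y' : Measure ((j : Fin m) → W j)).real S + δ) ∧
    ∀ y j, Integrable (fun w : (j : Fin m) → W j =>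
        excessRisk (W j) (ℓ j) (fun i => e i (y i)) (w j))
        (A y : Measure ((j : Fin m) → W j)) ∧
      ∫ w, excessRisk (W j) (ℓ j) (fun i => e i (y i)) (w j)
          ∂(A y : Measure ((j : Fin m) → W j)) ≤ b

open scoped InnerProductSpace

variable {m n : ℕ} {d : Fin m → ℕ} {X Y : Type*}
  {W : (j : Fin m) → Set (EuclideanSpace ℝ (Fin (d j)))}
  {ℓ : (j : Fin m) → EuclideanSpace ℝ (Fin (d j)) → X → ℝ} {R G : ℝ} {ε δ : ℝ}

theorem HasPrivateMechanism.mono {e : Fin n → Y → X} {b b' : ℝ}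
    (h : HasPrivateMechanism W ℓ ε δ e b) (hb : b ≤ b') : HasPrivateMechanism W ℓ ε δ e b' := by
  obtain ⟨A, hA, hAb⟩ := h
  exact ⟨A, hA, fun y j => ⟨(hAb y j).1, (hAb y j).2.trans hb⟩⟩

/-- The mechanism with a constant output. -/
theorem hasPrivateMechanism_constant (hn : 1 ≤ n) (hG : 0 ≤ G) (hWne : ∀ j, (W j).Nonempty)
    (hWR : ∀ j, W j ⊆ Metric.closedBall 0 R) (hℓ : ∀ j, IsConvexLipschitzLoss (W j) G (ℓ j))
    (hδ : 0 ≤ δ) (hε : 0 ≤ ε) (e : Fin n → Y → X) :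
    HasPrivateMechanism W ℓ ε δ e (2 * (R * G)) := by
  choose w₀ hw₀ using hWne
  obtain ⟨A, hA, hAint⟩ := exists_mechanism_of_weights (ι := Fin n) (Y := Y)
    (P := fun _ (_ : Unit) => (1 : ℝ)) (ε := ε) (δ := δ) (fun _ _ => zero_le_one) (fun _ => by simp)
    (fun _ _ _ _ S => by
      have h1 := Real.one_le_exp hε
      have h2 : (0 : ℝ) ≤ ∑ _ω ∈ S, (1 : ℝ) := Finset.sum_nonneg fun _ _ => zero_le_one
      nlinarith) (fun _ j => (⟨w₀ j, hw₀ j⟩ : W j))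
  refine ⟨A, hA, fun y j => ⟨(hAint y _).1, ?_⟩⟩
  rw [(hAint y _).2]
  simpa using excessRisk_le_of_subset_closedBall hn hG (hℓ j) (hWR j) (fun i => e i (y i)) (hw₀ j)

variable [Fintype Y]

/-- The mechanism combining private multiplicative weights with projected gradient steps. -/
theorem hasPrivateMechanism_multiplicativeWeights (hm : 1 ≤ m) (hn : 1 ≤ n)
    (hY : 2 ≤ Fintype.card Y) (hR : 0 < R) (hG : 0 < G) (hWne : ∀ j, (W j).Nonempty)
    (hWR : ∀ j, W j ⊆ Metric.closedBall 0 R) (hℓ : ∀ j, IsConvexLipschitzLoss (W j) G (ℓ j))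
    (hδ : 0 < δ) (hε : 0 < ε) (hεδ : ε ≤ Real.log (1 / δ)) {T : ℕ} (hT : 1 ≤ T) {τ : ℝ}
    (hτ : 0 < τ) (e : Fin n → Y → X) :
    HasPrivateMechanism W ℓ ε δ e
      (τ + G / T * (2 * R * √T + 20 * R * √(T * Real.log (Fintype.card Y))
            + 2 * R * T * (1 + Real.log m) * √(60 * T * Real.log (1 / δ)) / (ε * n))) := by
  have hn' : (0 : ℝ) < n := by exact_mod_cast hn
  have hT' : (0 : ℝ) < T := by exact_mod_cast hT
  choose F hFconv hFlip hFeq using fun (j : Fin m) (i : Fin n) (a : Y) =>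
    exists_convex_lipschitz_extension (hWne j) hG.le ((hℓ j).convexOn (e i a))
      ((hℓ j).lipschitz (e i a))
  have hFcont : ∀ j i a, Continuous (F j i a) := fun j i a =>
    (LipschitzWith.of_le_add_mul G.toNNReal fun x y => by
      rw [dist_eq_norm, Real.coe_toNNReal G hG.le]
      linarith [hFlip j i a x y]).continuous
  choose g hg using fun (j : Fin m) (w : EuclideanSpace ℝ (Fin (d j))) (i : Fin n) (a : Y) =>
    (hFconv j i a).exists_subgradient (hFcont j i a) w
  have hgn : ∀ j w i a, ‖g j w i a‖ ≤ G := fun j w i a =>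
    norm_subgradient_le hG.le (fun z => hFlip j i a z w) (hg j w i a)
  have hq : ∀ j w i a, ‖G⁻¹ • g j w i a‖ ≤ 1 := by
    intro j w i a
    rw [norm_smul, Real.norm_of_nonneg (by positivity), inv_mul_le_iff₀ hG, mul_one]
    exact hgn j w i a
  -- Projection needs closed sets, so the iterates live in the closures; the averaged iterate is
  -- moved back into `W j` at a loss of at most `τ`. Convexity of `W j` is read off a loss, which
  -- requires some example.
  obtain ⟨P, w, hP, hP1, hdp, hwK, hreg⟩ := exists_path_mechanism hm hn hY hq
    (K := fun j => closure (W j)) hR (fun j => (hWne j).closure) (fun j => isClosed_closure)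
    (fun j => by
      obtain ⟨i⟩ : Nonempty (Fin n) := ⟨⟨0, hn⟩⟩
      obtain ⟨a⟩ : Nonempty Y := Fintype.card_pos_iff.mp (by omega)
      exact ((hℓ j).convexOn (e i a)).1.closure)
    (fun j => closure_minimal (hWR j) Metric.isClosed_closedBall) hT hδ hε hεδ
  have hK : ∀ ω j, ∑ t, (1 / (T : ℝ)) • w ω t j ∈ closure (W j) := by
    intro ω j
    obtain ⟨i⟩ : Nonempty (Fin n) := ⟨⟨0, hn⟩⟩
    obtain ⟨a⟩ : Nonempty Y := Fintype.card_pos_iff.mp (by omega)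
    refine ((hℓ j).convexOn (e i a)).1.closure.sum_mem (fun _ _ => by positivity) ?_
      fun t _ => hwK ω t j
    simp only [Finset.sum_const, Finset.card_univ, Fintype.card_fin, nsmul_eq_mul]
    field_simp
  have hout : ∀ ω j, ∃ v : W j, ‖(v : EuclideanSpace ℝ (Fin (d j)))
      - ∑ t, (1 / (T : ℝ)) • w ω t j‖ ≤ τ / G := by
    intro ω j
    obtain ⟨v, hv, hd⟩ := Metric.mem_closure_iff.mp (hK ω j) (τ / G) (by positivity)
    exact ⟨⟨v, hv⟩, by rw [← dist_eq_norm, dist_comm]; exact hd.le⟩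
  choose out hout using hout
  obtain ⟨A, hA, hAint⟩ := exists_mechanism_of_weights (fun y ω => (hP y ω).le) hP1 hdp out
  refine ⟨A, hA, fun y j => ⟨(hAint y _).1, ?_⟩⟩
  rw [(hAint y _).2]
  refine sum_mul_excessRisk_le (out := fun ω => (out ω j : EuclideanSpace ℝ (Fin (d j))))
    (hP1 y) (hWne j) fun z hz => ?_
  have hloss : ∀ ω i, ℓ j (out ω j) (e i (y i)) - ℓ j z (e i (y i))
      ≤ τ + G / T * ∑ t, ⟪G⁻¹ • g j (w ω t j) i (y i), w ω t j - z⟫_ℝ := by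
    intro ω i
    rw [← hFeq j i (y i) _ (out ω j).2, ← hFeq j i (y i) z hz]
    have h1 := hFlip j i (y i) (out ω j) (∑ t, (1 / (T : ℝ)) • w ω t j)
    have h2 : G * ‖(out ω j : EuclideanSpace ℝ (Fin (d j))) - ∑ t, (1 / (T : ℝ)) • w ω t j‖
        ≤ τ := by
      have := mul_le_mul_of_nonneg_left (hout ω j) hG.le
      rwa [mul_div_cancel₀ _ hG.ne'] at this
    have hsum1 : ∑ _t : Fin T, 1 / (T : ℝ) = 1 := by
      simp only [Finset.sum_const, Finset.card_univ, Fintype.card_fin, nsmul_eq_mul]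
      field_simp
    have h3 : F j i (y i) (∑ t, (1 / (T : ℝ)) • w ω t j)
        ≤ ∑ t, (1 / (T : ℝ)) • F j i (y i) (w ω t j) :=
      (hFconv j i (y i)).map_sum_le (fun _ _ => by positivity) hsum1 fun _ _ => Set.mem_univ _
    have h4 : ∑ t, (1 / (T : ℝ)) • F j i (y i) (w ω t j) - F j i (y i) z
        ≤ G / T * ∑ t, ⟪G⁻¹ • g j (w ω t j) i (y i), w ω t j - z⟫_ℝ := by
      have e1 : F j i (y i) z = ∑ _t : Fin T, (1 / (T : ℝ)) * F j i (y i) z := by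
        rw [← Finset.sum_mul, hsum1, one_mul]
      rw [e1, ← Finset.sum_sub_distrib, Finset.mul_sum]
      refine Finset.sum_le_sum fun t _ => ?_
      have h5 := hg j (w ω t j) i (y i) z
      rw [← neg_sub (w ω t j) z, inner_neg_right] at h5
      have e2 : G / T * ⟪G⁻¹ • g j (w ω t j) i (y i), w ω t j - z⟫_ℝ
          = 1 / T * ⟪g j (w ω t j) i (y i), w ω t j - z⟫_ℝ := by
        rw [real_inner_smul_left]
        field_simp
      rw [e2, smul_eq_mul, ← mul_sub]
      refine mul_le_mul_of_nonneg_left ?_ (by positivity)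
      linarith
    linarith
  have hrisk : ∀ ω, empiricalRisk (ℓ j) (fun i => e i (y i)) (out ω j)
      - empiricalRisk (ℓ j) (fun i => e i (y i)) z
      ≤ τ + G / T * ∑ t, ⟪(1 / (n : ℝ)) • ∑ i, G⁻¹ • g j (w ω t j) i (y i), w ω t j - z⟫_ℝ := by
    intro ω
    rw [empiricalRisk, empiricalRisk, ← mul_sub, ← Finset.sum_sub_distrib]
    refine (mul_le_mul_of_nonneg_left (Finset.sum_le_sum fun i _ => hloss ω i)
      (by positivity)).trans (le_of_eq ?_)
    rw [Finset.sum_add_distrib, ← Finset.mul_sum, Finset.sum_comm, Finset.sum_const,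
      Finset.card_univ, Fintype.card_fin, nsmul_eq_mul]
    simp only [real_inner_smul_left (∑ i, _), sum_inner, ← Finset.mul_sum]
    field_simp
  calc ∑ ω, P y ω * (empiricalRisk (ℓ j) (fun i => e i (y i)) (out ω j)
        - empiricalRisk (ℓ j) (fun i => e i (y i)) z)
      ≤ ∑ ω, (P y ω * τ + G / T * (P y ω *
          ∑ t, ⟪(1 / (n : ℝ)) • ∑ i, G⁻¹ • g j (w ω t j) i (y i), w ω t j - z⟫_ℝ)) := by
        refine Finset.sum_le_sum fun ω _ => ?_
        have := mul_le_mul_of_nonneg_left (hrisk ω) (hP y ω).le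
        linarith
    _ = τ + G / T * ∑ ω, P y ω *
          ∑ t, ⟪(1 / (n : ℝ)) • ∑ i, G⁻¹ • g j (w ω t j) i (y i), w ω t j - z⟫_ℝ := by
        rw [Finset.sum_add_distrib, ← Finset.sum_mul, hP1, one_mul, Finset.mul_sum]
    _ ≤ _ := by
        have := mul_le_mul_of_nonneg_left (hreg y j z (subset_closure hz))
          (show 0 ≤ G / (T : ℝ) by positivity)
        linarith

/-- The mechanism releasing a noisy version of all the sensitive features. -/
theorem hasPrivateMechanism_randomizedResponse (hn : 1 ≤ n) (hR : 0 ≤ R) (hG : 0 ≤ G)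
    [Nonempty Y] (hWne : ∀ j, (W j).Nonempty)
    (hWR : ∀ j, W j ⊆ Metric.closedBall 0 R) (hℓ : ∀ j, IsConvexLipschitzLoss (W j) G (ℓ j))
    (hδ : 0 ≤ δ) (hε : 0 ≤ ε) {τ : ℝ} (hτ : 0 < τ) (e : Fin n → Y → X) :
    HasPrivateMechanism W ℓ ε δ e
      (τ + 2 * (R * G) * ((Fintype.card Y : ℝ) ^ n * Real.exp (-(ε / 2)))) := by
  classical
  -- An exponential mechanism on whole sensitive vectors. Scores range over `[0, ε / 2]`, so any two
  -- inputs, neighbors or not, have likelihood ratio at most `e^ε`.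
  set sc : (Fin n → Y) → (Fin n → Y) → ℝ := fun y y' => if y' = y then ε / 2 else 0 with hsc
  have hsc0 : ∀ y y', 0 ≤ sc y y' := fun y y' => by
    simp only [hsc]
    split_ifs <;> linarith
  have hsc1 : ∀ y y', sc y y' ≤ ε / 2 := fun y y' => by
    simp only [hsc]
    split_ifs <;> linarith
  have hratio : ∀ y y' a, softmax (sc y) a ≤ Real.exp ε * softmax (sc y') a := by
    intro y y' a
    have hZ := sum_exp_pos (sc y)
    have hZ' := sum_exp_pos (sc y')
    have h1 : ∀ y y' b, Real.exp (sc y b) ≤ Real.exp (ε / 2) * Real.exp (sc y' b) := by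
      intro y y' b
      rw [← Real.exp_add]
      exact Real.exp_le_exp.mpr (by linarith [hsc1 y b, hsc0 y' b])
    have h2 : ∑ b, Real.exp (sc y' b) ≤ Real.exp (ε / 2) * ∑ b, Real.exp (sc y b) := by
      rw [Finset.mul_sum]
      exact Finset.sum_le_sum fun b _ => h1 y' y b
    have h3 : Real.exp ε = Real.exp (ε / 2) * Real.exp (ε / 2) := by
      rw [← Real.exp_add, add_halves]
    rw [softmax, softmax, mul_div_assoc', div_le_div_iff₀ hZ hZ', h3]
    calc _ ≤ (Real.exp (ε / 2) * Real.exp (sc y' a)) *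
          (Real.exp (ε / 2) * ∑ b, Real.exp (sc y b)) :=
          mul_le_mul (h1 y y' a) h2 hZ'.le (by positivity)
      _ = _ := by ring
  have hbest : ∀ (a : Fin n → Y) (j : Fin m), ∃ v : W j,
      excessRisk (W j) (ℓ j) (fun i => e i (a i)) v ≤ τ := by
    intro a j
    obtain ⟨v, hv, hv'⟩ := exists_excessRisk_le (hWne j) (ℓ := ℓ j) (fun i => e i (a i)) hτ
    exact ⟨⟨v, hv⟩, hv'⟩
  choose out hout using hbest
  obtain ⟨A, hA, hAint⟩ := exists_mechanism_of_weights (P := fun y => softmax (sc y)) (ε := ε)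
    (δ := δ) (fun y ω => (softmax_pos _ ω).le) (fun y => sum_softmax _)
    (fun y y' _ _ S => by
      have : ∑ ω ∈ S, softmax (sc y) ω ≤ Real.exp ε * ∑ ω ∈ S, softmax (sc y') ω := by
        rw [Finset.mul_sum]
        exact Finset.sum_le_sum fun ω _ => hratio y y' ω
      linarith) out
  refine ⟨A, hA, fun y j => ⟨(hAint y _).1, ?_⟩⟩
  rw [(hAint y _).2]
  have hZ : Real.exp (ε / 2) ≤ ∑ b, Real.exp (sc y b) := by
    have := Finset.single_le_sum (f := fun b => Real.exp (sc y b))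
      (fun b _ => (Real.exp_pos _).le) (Finset.mem_univ y)
    simpa [hsc] using this
  -- The correct vector costs at most `τ`; each wrong one has probability at most `e^(-ε/2)` and
  -- adds at most the trivial risk.
  have hterm : ∀ a, softmax (sc y) a * excessRisk (W j) (ℓ j) (fun i => e i (y i)) (out a j)
      ≤ softmax (sc y) a * τ + 2 * (R * G) * Real.exp (-(ε / 2)) := by
    intro a
    have hRG : 0 ≤ 2 * (R * G) := by positivity
    by_cases h : a = y
    · subst h
      have := mul_le_mul_of_nonneg_left (hout a j) (softmax_pos (sc a) a).le
      have h2 : 0 ≤ 2 * (R * G) * Real.exp (-(ε / 2)) := mul_nonneg hRG (Real.exp_pos _).le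
      linarith
    · have h1 : softmax (sc y) a ≤ Real.exp (-(ε / 2)) := by
        have : sc y a = 0 := by simp [hsc, h]
        rw [softmax, this, Real.exp_zero, Real.exp_neg, ← one_div]
        exact one_div_le_one_div_of_le (Real.exp_pos _) hZ
      have h2 := excessRisk_le_of_subset_closedBall hn hG (hℓ j) (hWR j) (fun i => e i (y i))
        (out a j).2
      have h3 := mul_le_mul_of_nonneg_left h2 (softmax_pos (sc y) a).le
      have h4 := mul_le_mul_of_nonneg_right h1 hRG
      have h5 := mul_nonneg (softmax_pos (sc y) a).le hτ.le
      linarith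
  refine (Finset.sum_le_sum fun a _ => hterm a).trans (le_of_eq ?_)
  rw [Finset.sum_add_distrib, ← Finset.sum_mul, sum_softmax, one_mul, Finset.sum_const,
    Finset.card_univ, nsmul_eq_mul, Fintype.card_fun, Fintype.card_fin]
  push_cast
  ring

end Mechanisms

/-! ### Balancing the errors -/

section Rate

/-- The optimal number of rounds balances the errors of the iterative mechanism. -/
theorem error_le_of_rounds {a L ε N Lg M r T : ℝ} (ha : 1 / 2 ≤ a) (hL : 0 < L) (hε : 0 < ε)
    (hN : 0 < N) (hLg : 1 ≤ Lg) (hM0 : 0 ≤ M) (hM : 1 + M ≤ 4 * Lg) (hr : 0 ≤ r)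
    (hr2 : r ^ 2 = √(a * L) * Lg / (ε * N)) (hT1 : √(a / L) * (ε * N) / Lg ≤ T)
    (hT2 : T ≤ 2 * (√(a / L) * (ε * N) / Lg)) :
    1 / T * (2 * √T + 20 * √(T * a) + 2 * T * (1 + M) * √(60 * T * L) / (ε * N)) ≤ 112 * r := by
  have ha0 : 0 < a := by linarith
  obtain ⟨x, hx, rfl⟩ : ∃ x : ℝ, 0 < x ∧ a = x ^ 2 :=
    ⟨√a, Real.sqrt_pos.mpr ha0, (Real.sq_sqrt ha0.le).symm⟩
  obtain ⟨y, hy, rfl⟩ : ∃ y : ℝ, 0 < y ∧ L = y ^ 2 :=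
    ⟨√L, Real.sqrt_pos.mpr hL, (Real.sq_sqrt hL.le).symm⟩
  have hLg0 : 0 < Lg := by linarith
  rw [← mul_pow, Real.sqrt_sq (by positivity)] at hr2
  rw [← div_pow, Real.sqrt_sq (by positivity)] at hT1 hT2
  have hT0 : 0 < x / y * (ε * N) / Lg := by positivity
  have hT : 0 < T := hT0.trans_le hT1
  have h1 : √(x ^ 2 / T) ≤ r := by
    rw [Real.sqrt_le_iff]
    refine ⟨hr, ?_⟩
    rw [hr2]
    refine (div_le_div_of_nonneg_left (by positivity) hT0 hT1).trans (le_of_eq ?_)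
    field_simp
  -- The lower bound on `a` absorbs the term without `log k`: `1 ≤ 4 * a`.
  have h2 : √(1 / T) ≤ 2 * r := by
    have e : √(1 / T) ≤ √(2 ^ 2 * (x ^ 2 / T)) := by
      refine Real.sqrt_le_sqrt ?_
      rw [mul_div_assoc']
      gcongr
      linarith
    rw [Real.sqrt_mul (by positivity), Real.sqrt_sq (by norm_num)] at e
    linarith
  -- Rounding up at most doubles `T`, and `60 * 2 ≤ 11 ^ 2`.
  have h3 : √(60 * T * y ^ 2) ≤ 11 * (r * (ε * N) / Lg) := by
    rw [Real.sqrt_le_iff]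
    refine ⟨by positivity, ?_⟩
    have e : (11 * (r * (ε * N) / Lg)) ^ 2 = 121 * (x / y * (ε * N) / Lg) * y ^ 2 := by
      rw [mul_pow, div_pow, mul_pow, hr2]
      field_simp
      ring
    rw [e]
    exact mul_le_mul_of_nonneg_right (by linarith) (by positivity)
  have h4 : (1 + M) * √(60 * T * y ^ 2) / (ε * N) ≤ 44 * r := by
    rw [div_le_iff₀ (by positivity)]
    calc (1 + M) * √(60 * T * y ^ 2) ≤ (4 * Lg) * (11 * (r * (ε * N) / Lg)) := by gcongr
      _ = 44 * r * (ε * N) := by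
        field_simp
        ring
  have hsT : 0 < √T := Real.sqrt_pos.mpr hT
  have hTT : √T * √T = T := Real.mul_self_sqrt hT.le
  have e1 : 1 / T * (2 * √T) = 2 * √(1 / T) := by
    rw [Real.sqrt_div' _ hT.le, Real.sqrt_one]
    field_simp
    linarith
  have e2 : 1 / T * (20 * √(T * x ^ 2)) = 20 * √(x ^ 2 / T) := by
    rw [Real.sqrt_div' _ hT.le, Real.sqrt_mul hT.le, Real.sqrt_sq hx.le]
    field_simp
    linarith
  have e3 : 1 / T * (2 * T * (1 + M) * √(60 * T * y ^ 2) / (ε * N))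
      = 2 * ((1 + M) * √(60 * T * y ^ 2) / (ε * N)) := by
    field_simp
  -- The constant is `2 * 2 + 20 + 2 * 44 = 112`.
  rw [mul_add, mul_add, e1, e2, e3]
  linarith

/-- For `k ^ n * exp (-ε / 2)` in the large-`ε` regime. Together with `ε < L` the regime forces `√L
> 4 * N * a`, whence `N ≤ √(a * L)` and `1 / ε ≤ r ^ 2`; the exponential is then beaten by `exp (-ε
/ 2) ≤ 2 / ε`. -/
theorem exp_neg_quarter_le {a L ε N Lg r : ℝ} (ha : 1 / 2 ≤ a) (hε : 0 < ε)
    (hN : 1 ≤ N) (hLg : 1 ≤ Lg) (hr : 0 ≤ r) (hr2 : r ^ 2 = √(a * L) * Lg / (ε * N))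
    (hεL : ε < L) (h : 4 * N * a * √L < ε) : N * a - ε / 2 ≤ -(ε / 4) ∧
      Real.exp (-(ε / 4)) ≤ 2 * r := by
  have hL : 0 < L := hε.trans hεL
  have hs : 0 < √L := Real.sqrt_pos.mpr hL
  have hss : √L * √L = L := Real.mul_self_sqrt hL.le
  have hNa : 4 * N * a < √L := by
    have : 4 * N * a * √L < √L * √L := by linarith
    exact lt_of_mul_lt_mul_right this hs.le
  have hNa1 : 2 ≤ 4 * N * a := by nlinarith
  refine ⟨by nlinarith, ?_⟩
  have hr3 : 1 / ε ≤ r ^ 2 := by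
    rw [hr2, div_le_div_iff₀ hε (by positivity), Real.sqrt_mul (by linarith)]
    have h1 : 1 / 2 ≤ √a := Real.le_sqrt_of_sq_le (by linarith)
    have h2 : N ≤ √a * √L := by
      have h3 : 2 * N ≤ √L := by nlinarith
      nlinarith
    have h4 : N ≤ √a * √L * Lg := h2.trans (le_mul_of_one_le_right (by positivity) hLg)
    nlinarith
  refine le_of_sq_le_sq ?_ (by positivity)
  have h5 : Real.exp (-(ε / 4)) ^ 2 = (Real.exp (ε / 2))⁻¹ := by
    rw [← Real.exp_nat_mul, ← Real.exp_neg]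
    congr 1
    push_cast
    ring
  rw [h5, mul_pow]
  have h6 : ε / 2 ≤ Real.exp (ε / 2) := by linarith [Real.add_one_le_exp (ε / 2)]
  have h7 : (Real.exp (ε / 2))⁻¹ ≤ (ε / 2)⁻¹ := inv_anti₀ (by positivity) h6
  have h8 : (ε / 2)⁻¹ = 2 * (1 / ε) := by field_simp
  linarith [sq_nonneg r]

end Rate

/-! ### The main theorem -/

theorem mainTheorem1 :
    ∃ C : ℝ, 0 < C ∧
      ∀ (Xpub : Type*) (Xpriv : Type*) [Fintype Xpriv] (_hk : 2 ≤ Fintype.card Xpriv)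
        (m n : ℕ) (_hm : 1 ≤ m) (_hn : 1 ≤ n)
        (R G : ℝ) (_hR : 0 ≤ R) (_hG : 0 ≤ G)
        (d : Fin m → ℕ)
        (W : (j : Fin m) → Set (EuclideanSpace ℝ (Fin (d j))))
        (_hWne : ∀ j, (W j).Nonempty)
        (_hWR : ∀ j, W j ⊆ Metric.closedBall 0 R)
        (ℓ : (j : Fin m) → EuclideanSpace ℝ (Fin (d j)) → Xpub × Xpriv → ℝ)
        (_hℓ : ∀ j, IsConvexLipschitzLoss (W j) G (ℓ j))
        (δ ε : ℝ) (_hδ : 0 < δ) (_hδ' : δ < 1 / 2) (_hε : 0 < ε) (_hε' : ε < Real.log (1 / δ)),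
        ∃ A : Dataset Xpub Xpriv n → ProbabilityMeasure ((j : Fin m) → W j),
          IsSemiSensitiveDP ε δ A ∧
          ∀ (D : Dataset Xpub Xpriv n) (j : Fin m),
            Integrable (fun w : (j : Fin m) → W j => excessRisk (W j) (ℓ j) D (w j))
              (A D : Measure ((j : Fin m) → W j)) ∧
            ∫ w, excessRisk (W j) (ℓ j) D (w j) ∂(A D : Measure ((j : Fin m) → W j))
              ≤ C * convexRate R G ε δ m n (Fintype.card Xpriv) := by
  -- `112` from `error_le_of_rounds` and `1` from the slack `τ = R * G * r`.
  refine ⟨113, by norm_num, ?_⟩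
  intro Xpub Xpriv _ hk m n hm hn R G hR hG d W hWne hWR ℓ hℓ δ ε hδ hδ' hε hε'
  refine exists_isSemiSensitiveDP_of_forall_public
    (Q := fun D (μ : ProbabilityMeasure ((j : Fin m) → W j)) => ∀ j, Integrable (fun w : (j : Fin m) → W j => excessRisk (W j) (ℓ j) D (w j))
      (μ : Measure ((j : Fin m) → W j)) ∧
        ∫ w, excessRisk (W j) (ℓ j) D (w j) ∂(μ : Measure ((j : Fin m) → W j))
          ≤ 113 * convexRate R G ε δ m n (Fintype.card Xpriv)) fun x => ?_
  have : Nonempty Xpriv := Fintype.card_pos_iff.mp (by omega)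
  have hn' : (1 : ℝ) ≤ n := by exact_mod_cast hn
  have hm' : (1 : ℝ) ≤ m := by exact_mod_cast hm
  set k := Fintype.card Xpriv
  have hk' : (2 : ℝ) ≤ k := by exact_mod_cast hk
  set a := Real.log k with ha_def
  set L := Real.log (1 / δ) with hL_def
  set Lg := max 1 (Real.log ((m : ℝ) * n) + Real.log a + Real.log (√L / ε)) with hLg_def
  have hLg1 : 1 ≤ Lg := le_max_left _ _
  have ha : 1 / 2 ≤ a := by
    have := Real.log_le_log (by norm_num) hk'
    linarith [Real.log_two_gt_d9]
  have hL : 0 < L := hε.trans hε'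
  set r := (a * L) ^ (1 / 4 : ℝ) * √Lg / √(ε * n) with hr_def
  have hrate : convexRate R G ε δ m n k = R * G * r := rfl
  have hr : 0 ≤ r := by positivity
  have hrpos : 0 < r := by positivity
  have hr2 : r ^ 2 = √(a * L) * Lg / (ε * n) := by
    rw [hr_def, div_pow, mul_pow, Real.sq_sqrt (by positivity), Real.sq_sqrt (by positivity),
      ← Real.rpow_natCast, ← Real.rpow_mul (by positivity), Real.sqrt_eq_rpow]
    norm_num
  have hRG : 0 ≤ R * G := mul_nonneg hR hG
  change HasPrivateMechanism W ℓ ε δ (fun i b => (x i, b)) (113 * (R * G * r))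
  -- If the balanced number of rounds is below one, then `r ^ 2 ≥ a ≥ 1 / 2`, and the trivial risk
  -- `2 * (R * G)` is within the bound.
  by_cases htriv : R * G = 0 ∨ √(a / L) * (ε * n) / Lg < 1
  · refine (hasPrivateMechanism_constant hn hG hWne hWR hℓ hδ.le hε.le _).mono ?_
    rcases htriv with h0 | hT
    · simp [h0]
    · have hr1 : 1 / 2 ≤ r := by
        have h1 : a ≤ r ^ 2 := by
          have e : r ^ 2 * (√(a / L) * (ε * n) / Lg) = a := by
            have h2 : √(a * L) * √(a / L) = a := by
              rw [← Real.sqrt_mul (by positivity), show a * L * (a / L) = a ^ 2 by field_simp,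
                Real.sqrt_sq (by linarith)]
            rw [hr2]
            field_simp
            linarith
          rw [← e]
          exact mul_le_of_le_one_right (sq_nonneg r) hT.le
        nlinarith
      nlinarith
  push Not at htriv
  obtain ⟨hRG0, hT0⟩ := htriv
  have hRpos : 0 < R := lt_of_le_of_ne hR fun h => hRG0 (by rw [← h, zero_mul])
  have hGpos : 0 < G := lt_of_le_of_ne hG fun h => hRG0 (by rw [← h, mul_zero])
  have hτ : 0 < R * G * r := by positivity
  by_cases hlarge : 4 * n * a * √L < ε
  · refine (hasPrivateMechanism_randomizedResponse hn hR hG hWne hWR hℓ hδ.le hε.le hτ _).mono ?_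
    obtain ⟨h1, h2⟩ := exp_neg_quarter_le ha hε hn' hLg1 hr hr2 hε' hlarge
    have h3 : (k : ℝ) ^ n * Real.exp (-(ε / 2)) ≤ 2 * r := by
      refine le_trans ?_ h2
      have : (k : ℝ) ^ n = Real.exp (n * a) := by
        rw [Real.exp_nat_mul, ha_def, Real.exp_log (by linarith)]
      rw [this, ← Real.exp_add]
      exact Real.exp_le_exp.mpr (by linarith)
    have := mul_le_mul_of_nonneg_left h3 (show 0 ≤ 2 * (R * G) by linarith)
    change R * G * r + 2 * (R * G) * ((k : ℝ) ^ n * Real.exp (-(ε / 2))) ≤ _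
    linarith
  · push Not at hlarge
    set T := ⌈√(a / L) * (ε * n) / Lg⌉₊ with hT_def
    have hT1 : √(a / L) * (ε * n) / Lg ≤ T := Nat.le_ceil _
    have hT2 : (T : ℝ) ≤ 2 * (√(a / L) * (ε * n) / Lg) := by
      have := Nat.ceil_lt_add_one (show 0 ≤ √(a / L) * (ε * n) / Lg by linarith)
      linarith
    have hT : 1 ≤ T := Nat.one_le_ceil_iff.mpr (by linarith)
    refine (hasPrivateMechanism_multiplicativeWeights hm hn hk hRpos hGpos hWne hWR hℓ hδ hε hε'.le
      hT hτ _).mono ?_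
    have hM0 : 0 ≤ Real.log m := Real.log_nonneg hm'
    -- Outside the large-`ε` regime `n * a * √L / ε ≥ 1 / 4`, so the other logarithms in the rate
    -- cancel at most `log 4` of `log m`.
    have hM : 1 + Real.log m ≤ 4 * Lg := by
      have h1 : Real.log m + Real.log (n * a * √L / ε)
          = Real.log ((m : ℝ) * n) + Real.log a + Real.log (√L / ε) := by
        have hs : 0 < √L := Real.sqrt_pos.mpr hL
        rw [← Real.log_mul (by positivity) (by positivity),
          ← Real.log_mul (by positivity) (by positivity),
          ← Real.log_mul (by positivity) (by positivity)]
        congr 1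
        ring
      have h2 : Real.log m + Real.log (n * a * √L / ε) ≤ Lg := by
        rw [h1]
        exact le_max_right _ _
      have h3 : Real.log (1 / 4) ≤ Real.log (n * a * √L / ε) := by
        refine Real.log_le_log (by norm_num) ?_
        rw [div_le_div_iff₀ (by norm_num) hε]
        linarith
      have h4 : Real.log (1 / 4) = -(2 * Real.log 2) := by
        rw [one_div, Real.log_inv, show (4 : ℝ) = 2 ^ 2 by norm_num, Real.log_pow]
        norm_num
      linarith [Real.log_two_lt_d9]
    have herr := error_le_of_rounds ha hL hε (by linarith : (0 : ℝ) < n) hLg1 hM0 hM hr hr2 hT1 hT2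
    have := mul_le_mul_of_nonneg_left herr hRG
    calc _ = R * G * r + R * G * (1 / (T : ℝ) * (2 * √T + 20 * √(T * a)
          + 2 * T * (1 + Real.log m) * √(60 * T * L) / (ε * n))) := by ring
      _ ≤ 113 * (R * G * r) := by linarith
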